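/- Let $k$ be a field of characteristic $0$, let $X$ be an irreducible scheme of finite type over $k$ that is regular (all local rings $\mathcal O_{X,x}$ are regular), let $M$ be a locally free $\mathcal O_X$-module of finite rank, and let $V\subset\Gamma(X,M)$ be a finite-dimensional $k$-subspace. For $n\ge 0$ let $\mathcal P^n_{X/k}=\Delta^{-1}(\mathcal O_{X\times_k X})/I_\Delta^{n+1}$ be the sheaf of principal parts of order $n$, where $\Delta:X\to X\times_k X$ is the diagonal and $I_\Delta=\ker(\Delta^{-1}\mathcal O_{X\times_kX}\to\mathcal O_X)$; put $\mathcal P^n_{X/k}(M)=\mathcal P^n_{X/k}\otimes_{\mathcal O_X}M$ (tensor product along the second factor, regarded as an $\mathcal O_X$-module through the first factor), let $d^n:M\to\mathcal P^n_{X/k}(M)$, $m\mapsto 1\otimes m$, and let $\mathcal D^n_{X/k}(M)=\mathcal Hom_{\mathcal O_X}(\mathcal P^n_{X/k}(M),M)$ be the $\mathcal O_X$-module of differential operators of order at most $n$ on $M$, acting on $M$ by $P\cdot m=P(d^n m)$. Let $\mathrm{Ann}^nV\subset\mathcal D^n_{X/k}(M)$ be the submodule of those $P$ with $P\cdot v=0$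 for all $v\in V$, and let $W^n:\mathcal D^n_{X/k}(M)\to V^*\otimes_kM$ be the map that sends $P$ to the element corresponding to $v\mapsto P\cdot v$ under $V^*\otimes_kM=\mathrm{Hom}_k(V,M)$, where $V^*=\mathrm{Hom}_k(V,k)$. For $x\in X$ with residue field $k_x$ let $$d^n_V(x):k_x\otimes_kV\to k_x\otimes_{\mathcal O_{X,x}}\mathcal P^n_{X/k}(M)_x,\qquad c\otimes v\mapsto c\otimes d^n(v)_x.$$ Assume that $V$ is separated, i.e. for every $x\in X$ the map $d^n_V(x)$ is injective for all sufficiently large $n$. Let $n_{inj}(x)$ be the smallest $n\ge 0$ such that $d^n_V(x)$ is injective, and let $n_{inj}(V)=\sup_{x\in X}n_{inj}(x)$. Then for every integer $n\ge n_{inj}(V)$ the sequence of $\mathcal O_X$-modules $$0\to\mathrm{Ann}^nV\to\mathcal D^n_{X/k}(M)\xrightarrow{\;W^n\;}V^*\otimes_kM\to0$$ is exact, and it is locally split: every point of $X$ has an open neighbourhood $U$ such that the restriction of the sequence to $U$ is a split exact sequence of $\mathcal O_U$-modules. -/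

import Mathlib

open CategoryTheory AlgebraicGeometry TopologicalSpace Opposite
open scoped TensorProduct

universe u

noncomputable section

/-! ### Principal parts of algebras and modules -/

section Algebra

/-- The algebra `(R ⊗[k] R) ⧸ I ^ (n + 1)` of principal parts of order `n` of a `k`-algebra `R`,
where `I` is the kernel of the multiplication `R ⊗[k] R → R`. -/
def PrincipalParts (k R : Type*) [CommRing k] [CommRing R] [Algebra k R] (n : ℕ) : Type _ :=
  (R ⊗[k] R) ⧸ (KaehlerDifferential.ideal k R ^ (n + 1))

variable (k R S : Type*) [CommRing k] [CommRing R] [Algebra k R] [CommRing S] [Algebra k S] (n : ℕ)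

instance : CommRing (PrincipalParts k R n) :=
  inferInstanceAs (CommRing ((R ⊗[k] R) ⧸ (KaehlerDifferential.ideal k R ^ (n + 1))))

namespace PrincipalParts

/-- The projection `R ⊗[k] R → PrincipalParts k R n`. -/
def mk : R ⊗[k] R →+* PrincipalParts k R n :=
  Ideal.Quotient.mk (KaehlerDifferential.ideal k R ^ (n + 1))

/-- The structure map `r ↦ r ⊗ 1`. -/
def left : R →+* PrincipalParts k R n :=
  (mk k R n).comp (Algebra.TensorProduct.includeLeft : R →ₐ[k] R ⊗[k] R).toRingHom

/-- The structure map `r ↦ 1 ⊗ r`. -/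
def right : R →+* PrincipalParts k R n :=
  (mk k R n).comp (Algebra.TensorProduct.includeRight : R →ₐ[k] R ⊗[k] R).toRingHom

/-- As an `R`-algebra, `PrincipalParts k R n` is regarded through the *right* structure map;
this is the structure along which it is tensored with modules. -/
instance : Algebra R (PrincipalParts k R n) := (right k R n).toAlgebra

variable {k R S}

lemma left_algebraMap (c : k) :
    left k R n (algebraMap k R c) = right k R n (algebraMap k R c) := by
  simp only [left, right, RingHom.comp_apply]
  congr 1
  simp

/-- Functoriality of the principal parts in the algebra. -/
def map (φ : R →ₐ[k] S) : PrincipalParts k R n →+* PrincipalParts k S n :=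
  Ideal.quotientMap _ (Algebra.TensorProduct.map φ φ).toRingHom <| by
    rw [← Ideal.map_le_iff_le_comap, Ideal.map_pow]
    refine Ideal.pow_right_mono ?_ _
    rw [Ideal.map_le_iff_le_comap]
    intro x hx
    simp only [KaehlerDifferential.ideal, RingHom.mem_ker, Ideal.mem_comap] at hx ⊢
    have : ∀ y : R ⊗[k] R, Algebra.TensorProduct.lmul' (S := S) k (Algebra.TensorProduct.map φ φ y) =
        φ (Algebra.TensorProduct.lmul' (S := R) k y) := by
      intro y
      induction y with
      | zero => simp
      | tmul a b => simp
      | add a b ha hb => simp only [map_add, ha, hb]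
    exact (this x).trans (by rw [show Algebra.TensorProduct.lmul' (S := R) k x = 0 from hx, map_zero])

lemma map_mk (φ : R →ₐ[k] S) (x : R ⊗[k] R) :
    map n φ (mk k R n x) = mk k S n (Algebra.TensorProduct.map φ φ x) := rfl

lemma mk_surjective : Function.Surjective (mk k R n) := Ideal.Quotient.mk_surjective

@[simp]
lemma map_left (φ : R →ₐ[k] S) (r : R) : map n φ (left k R n r) = left k S n (φ r) := by
  simp [left, map_mk]

@[simp]
lemma map_right (φ : R →ₐ[k] S) (r : R) : map n φ (right k R n r) = right k S n (φ r) := by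
  simp [right, map_mk]

lemma map_id (x : PrincipalParts k R n) : map n (AlgHom.id k R) x = x := by
  obtain ⟨x, rfl⟩ := mk_surjective n x
  simp [map_mk]

lemma map_comp {T : Type*} [CommRing T] [Algebra k T] (φ : R →ₐ[k] S) (ψ : S →ₐ[k] T)
    (x : PrincipalParts k R n) : map n (ψ.comp φ) x = map n ψ (map n φ x) := by
  obtain ⟨x, rfl⟩ := mk_surjective n x
  simp only [map_mk]
  congr 1
  rw [← AlgHom.comp_apply, ← Algebra.TensorProduct.map_comp]

end PrincipalParts

/-- The module `PrincipalParts k R n ⊗[R] M` of principal parts of order `n` of an `R`-module `M`.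
The tensor product is formed with the right `R`-module structure of `PrincipalParts k R n`. -/
def ModulePrincipalParts (k R : Type*) [CommRing k] [CommRing R] [Algebra k R] (n : ℕ)
    (M : Type*) [AddCommGroup M] [Module R M] : Type _ :=
  PrincipalParts k R n ⊗[R] M

namespace ModulePrincipalParts

variable (M : Type*) [AddCommGroup M] [Module R M]

instance : AddCommGroup (ModulePrincipalParts k R n M) :=
  inferInstanceAs (AddCommGroup (PrincipalParts k R n ⊗[R] M))

instance : Module (PrincipalParts k R n) (ModulePrincipalParts k R n M) :=
  inferInstanceAs (Module (PrincipalParts k R n) (PrincipalParts k R n ⊗[R] M))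

/-- The `R`-module structure on `ModulePrincipalParts k R n M` comes from the left structure map
`R → PrincipalParts k R n`. -/
instance : Module R (ModulePrincipalParts k R n M) :=
  Module.compHom _ (PrincipalParts.left k R n)

variable {k R S M}

lemma smul_def (r : R) (x : ModulePrincipalParts k R n M) :
    r • x = PrincipalParts.left k R n r • x := rfl

/-- The pure tensor `p ⊗ m`. -/
def tmul (p : PrincipalParts k R n) (m : M) : ModulePrincipalParts k R n M := p ⊗ₜ[R] m

lemma smul_tmul (p q : PrincipalParts k R n) (m : M) :
    p • tmul n q m = tmul n (p * q) m := rfl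

lemma tmul_smul (p : PrincipalParts k R n) (r : R) (m : M) :
    tmul n p (r • m) = tmul n (PrincipalParts.right k R n r * p) m := by
  refine (TensorProduct.smul_tmul r p m).symm.trans ?_
  rw [Algebra.smul_def]; rfl

@[elab_as_elim]
lemma induction_on {P : ModulePrincipalParts k R n M → Prop} (x : ModulePrincipalParts k R n M)
    (zero : P 0) (tmul : ∀ p m, P (tmul n p m)) (add : ∀ x y, P x → P y → P (x + y)) : P x :=
  TensorProduct.induction_on x zero tmul add

variable {N : Type*} [AddCommGroup N] [Module S N]

/-- Functoriality of the module of principal parts: `p ⊗ m ↦ φ(p) ⊗ ψ(m)`. -/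
def map (φ : R →ₐ[k] S) (ψ : M →+ N) (h : ∀ (r : R) (m : M), ψ (r • m) = φ r • ψ m) :
    ModulePrincipalParts k R n M →+ ModulePrincipalParts k S n N :=
  TensorProduct.liftAddHom (R := R) (M := PrincipalParts k R n) (N := M)
    (AddMonoidHom.mk' (fun p ↦ AddMonoidHom.mk'
        (fun m ↦ tmul n (PrincipalParts.map n φ p) (ψ m))
        (fun m m' ↦ by rw [map_add]; exact TensorProduct.tmul_add _ _ _))
      (fun p p' ↦ by ext m; simp only [map_add]; exact TensorProduct.add_tmul _ _ _))
    (fun r p m ↦ by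
      simp only [AddMonoidHom.mk'_apply, h, tmul_smul, Algebra.smul_def, map_mul]
      congr 2
      exact PrincipalParts.map_right n φ r)

@[simp]
lemma map_tmul (φ : R →ₐ[k] S) (ψ : M →+ N) (h : ∀ (r : R) (m : M), ψ (r • m) = φ r • ψ m)
    (p : PrincipalParts k R n) (m : M) :
    map n φ ψ h (tmul n p m) = tmul n (PrincipalParts.map n φ p) (ψ m) := rfl

lemma map_smul (φ : R →ₐ[k] S) (ψ : M →+ N) (h : ∀ (r : R) (m : M), ψ (r • m) = φ r • ψ m)
    (r : R) (x : ModulePrincipalParts k R n M) :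
    map n φ ψ h (r • x) = φ r • map n φ ψ h x := by
  induction x using induction_on with
  | zero => simp
  | tmul p m => simp only [smul_def, smul_tmul, map_tmul, map_mul, PrincipalParts.map_left]
  | add x y hx hy => simp only [smul_add, map_add, hx, hy]

/-- The canonical map `M → PrincipalParts k R n ⊗[R] M`, `m ↦ 1 ⊗ m`. -/
def d (k R : Type*) [CommRing k] [CommRing R] [Algebra k R] (n : ℕ)
    (M : Type*) [AddCommGroup M] [Module R M] : M →+ ModulePrincipalParts k R n M :=
  AddMonoidHom.mk' (fun m ↦ tmul n 1 m) (fun _ _ ↦ TensorProduct.tmul_add _ _ _)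

lemma d_apply (m : M) : d k R n M m = tmul n 1 m := rfl

lemma map_d (φ : R →ₐ[k] S) (ψ : M →+ N) (h : ∀ (r : R) (m : M), ψ (r • m) = φ r • ψ m) (m : M) :
    map n φ ψ h (d k R n M m) = d k S n N (ψ m) := by
  simp [d_apply]

lemma d_smul (c : k) (m : M) :
    d k R n M (algebraMap k R c • m) = algebraMap k R c • d k R n M m := by
  simp only [d_apply, tmul_smul, smul_def, smul_tmul, PrincipalParts.left_algebraMap]

end ModulePrincipalParts

end Algebra

/-! ### The sheaf of principal parts -/

namespace AlgebraicGeometry.Scheme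

section OverField

variable (k : Type u) [Field k] {X : Scheme.{u}} [X.Over (Spec (CommRingCat.of k))]

/-- The ring homomorphism `k → Γ(X, U)` of a `k`-scheme `X`. -/
def fieldToSections (U : X.Opens) : k →+* Γ(X, U) :=
  ((Scheme.ΓSpecIso (CommRingCat.of k)).inv ≫ (X ↘ Spec (CommRingCat.of k)).appTop ≫
    X.presheaf.map (homOfLE le_top).op).hom

lemma map_fieldToSections {U W : X.Opens} (i : W ⟶ U) (c : k) :
    X.presheaf.map i.op (fieldToSections k U c) = fieldToSections k W c := by
  have h : X.presheaf.map (homOfLE (le_top : U ≤ ⊤)).op ≫ X.presheaf.map i.op =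
      X.presheaf.map (homOfLE (le_top : W ≤ ⊤)).op := by
    rw [← Functor.map_comp]; rfl
  exact congr($h ((X ↘ Spec (CommRingCat.of k)).appTop
    ((Scheme.ΓSpecIso (CommRingCat.of k)).inv c)))

instance algebraSections (U : X.Opens) : Algebra k Γ(X, U) := (fieldToSections k U).toAlgebra

instance moduleSections (M : X.Modules) (U : X.Opens) : Module k Γ(M, U) :=
  Module.compHom _ (fieldToSections k U)

instance isScalarTowerSections (M : X.Modules) (U : X.Opens) :
    IsScalarTower k Γ(X, U) Γ(M, U) :=
  ⟨fun c r m ↦ by rw [Algebra.smul_def, mul_smul]; rfl⟩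

/-- Restriction of functions as a homomorphism of `k`-algebras. -/
def resAlgHom {U W : X.Opens} (i : W ⟶ U) : Γ(X, U) →ₐ[k] Γ(X, W) where
  __ := (X.presheaf.map i.op).hom
  commutes' c := map_fieldToSections k i c

/-- Restriction of sections of a sheaf of modules as a `k`-linear map. -/
def Modules.resₗ (M : X.Modules) {U W : X.Opens} (i : W ⟶ U) : Γ(M, U) →ₗ[k] Γ(M, W) where
  __ := (M.presheaf.map i.op).hom
  map_smul' c m := by
    refine (M.map_smul i (fieldToSections k U c) m).trans ?_
    rw [map_fieldToSections]; rfl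

@[simp]
lemma Modules.resₗ_apply (M : X.Modules) {U W : X.Opens} (i : W ⟶ U) (m : Γ(M, U)) :
    M.resₗ k i m = M.presheaf.map i.op m := rfl

/-- The restriction maps `p ⊗ m ↦ p|_W ⊗ m|_W` of the modules of principal parts. -/
def principalPartsRes (M : X.Modules) (n : ℕ) {U W : X.Opens} (i : W ⟶ U) :
    ModulePrincipalParts k Γ(X, U) n Γ(M, U) →+ ModulePrincipalParts k Γ(X, W) n Γ(M, W) :=
  ModulePrincipalParts.map n (resAlgHom k i) (M.presheaf.map i.op).hom
    (fun r m ↦ M.map_smul i r m)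

lemma principalPartsRes_tmul (M : X.Modules) (n : ℕ) {U W : X.Opens} (i : W ⟶ U)
    (p : PrincipalParts k Γ(X, U) n) (m : Γ(M, U)) :
    principalPartsRes k M n i (ModulePrincipalParts.tmul n p m) =
      ModulePrincipalParts.tmul n (PrincipalParts.map n (resAlgHom k i) p)
        (M.presheaf.map i.op m) := rfl

lemma principalPartsRes_smul (M : X.Modules) (n : ℕ) {U W : X.Opens} (i : W ⟶ U) (r : Γ(X, U))
    (x : ModulePrincipalParts k Γ(X, U) n Γ(M, U)) :
    principalPartsRes k M n i (r • x) = X.presheaf.map i.op r • principalPartsRes k M n i x :=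
  ModulePrincipalParts.map_smul n (resAlgHom k i) (M.presheaf.map i.op).hom
    (fun r m ↦ M.map_smul i r m) r x

lemma principalPartsRes_id (M : X.Modules) (n : ℕ) (U : X.Opens)
    (x : ModulePrincipalParts k Γ(X, U) n Γ(M, U)) : principalPartsRes k M n (𝟙 U) x = x := by
  induction x using ModulePrincipalParts.induction_on with
  | zero => simp
  | tmul p m =>
    have h : resAlgHom k (𝟙 U) = AlgHom.id k Γ(X, U) := by
      ext x; exact congr($(X.presheaf.map_id (op U)) x)
    have h2 : M.presheaf.map (𝟙 U).op m = m := congr($(M.presheaf.map_id (op U)) m)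
    rw [principalPartsRes_tmul, h, PrincipalParts.map_id, h2]
  | add x y hx hy => rw [map_add, hx, hy]

lemma principalPartsRes_comp (M : X.Modules) (n : ℕ) {U W Z : X.Opens} (i : W ⟶ U) (j : Z ⟶ W)
    (x : ModulePrincipalParts k Γ(X, U) n Γ(M, U)) :
    principalPartsRes k M n (j ≫ i) x =
      principalPartsRes k M n j (principalPartsRes k M n i x) := by
  induction x using ModulePrincipalParts.induction_on with
  | zero => simp
  | tmul p m =>
    have h : resAlgHom k (j ≫ i) = (resAlgHom k j).comp (resAlgHom k i) := by
      ext x; exact congr($(X.presheaf.map_comp i.op j.op) x)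
    have h2 : M.presheaf.map (j ≫ i).op m = M.presheaf.map j.op (M.presheaf.map i.op m) :=
      congr($(M.presheaf.map_comp i.op j.op) m)
    simp only [principalPartsRes_tmul]
    rw [h, PrincipalParts.map_comp, h2]
  | add x y hx hy => rw [map_add, hx, hy, map_add, map_add]

/-- The presheaf of abelian groups
`U ↦ PrincipalParts k Γ(X, U) n ⊗[Γ(X, U)] Γ(M, U)`. -/
def principalPartsAb (M : X.Modules) (n : ℕ) : TopCat.Presheaf Ab.{u} X where
  obj U := AddCommGrpCat.of (ModulePrincipalParts k Γ(X, U.unop) n Γ(M, U.unop))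
  map i := AddCommGrpCat.ofHom (principalPartsRes k M n i.unop)
  map_id U := by ext x; exact principalPartsRes_id k M n U.unop x
  map_comp i j := by ext x; exact principalPartsRes_comp k M n i.unop j.unop x

instance modulePrincipalPartsAb (M : X.Modules) (n : ℕ) (U : X.Opensᵒᵖ) :
    Module (X.ringCatSheaf.obj.obj U) ((principalPartsAb k M n).obj U) :=
  inferInstanceAs (Module Γ(X, U.unop) (ModulePrincipalParts k Γ(X, U.unop) n Γ(M, U.unop)))

/-- The presheaf of modules `U ↦ PrincipalParts k Γ(X, U) n ⊗[Γ(X, U)] Γ(M, U)`, regarded as a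
module over `𝒪_X` through the left factor. -/
def principalPartsPresheaf (M : X.Modules) (n : ℕ) : X.PresheafOfModules :=
  PresheafOfModules.ofPresheaf (principalPartsAb k M n)
    (fun _ _ i r m ↦ principalPartsRes_smul k M n i.unop r m)

/-- The sheaf `𝒫ⁿ_{X/k}(M)` of principal parts of order `n` of an `𝒪_X`-module `M`. It is the
sheaf associated with `U ↦ PrincipalParts k Γ(X, U) n ⊗[Γ(X, U)] Γ(M, U)`; as the formation of
`PrincipalParts` commutes with filtered colimits, its stalk at `x` is
`(𝒪_{X,x} ⊗[k] 𝒪_{X,x} ⧸ I ^ (n + 1)) ⊗ M_x`, so that this is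
`Δ⁻¹(𝒪_{X × X}) ⧸ I_Δ ^ (n + 1) ⊗ M`. -/
def principalParts (M : X.Modules) (n : ℕ) : X.Modules :=
  (PresheafOfModules.sheafification (𝟙 X.ringCatSheaf.obj)).obj (principalPartsPresheaf k M n)

/-- The canonical map from the presheaf to the sheaf of principal parts. -/
def toPrincipalParts (M : X.Modules) (n : ℕ) :
    principalPartsAb k M n ⟶ (principalParts k M n).presheaf :=
  toSheafify (Opens.grothendieckTopology X) (principalPartsAb k M n)

lemma toPrincipalParts_smul (M : X.Modules) (n : ℕ) (U : X.Opens) (r : Γ(X, U))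
    (p : ModulePrincipalParts k Γ(X, U) n Γ(M, U)) :
    (toPrincipalParts k M n).app (op U) (r • p) =
      r • ((toPrincipalParts k M n).app (op U) p : Γ(principalParts k M n, U)) := by
  have h := ((PresheafOfModules.sheafificationHomEquiv (𝟙 X.ringCatSheaf.obj)
    (P := principalPartsPresheaf k M n) (𝟙 _)).app (op U)).hom.map_smul r p
  have h0 := PresheafOfModules.toPresheaf_map_sheafificationHomEquiv_def (𝟙 X.ringCatSheaf.obj)
    (P := principalPartsPresheaf k M n) (𝟙 _)
  have h1 : ∀ q : ModulePrincipalParts k Γ(X, U) n Γ(M, U),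
      ((PresheafOfModules.sheafificationHomEquiv (𝟙 X.ringCatSheaf.obj)
    (P := principalPartsPresheaf k M n) (𝟙 _)).app (op U)).hom q =
      (toPrincipalParts k M n).app (op U) q := fun q ↦ congr(($h0).app (op U) q)
  exact (h1 (r • p)).symm.trans (h.trans (congrArg
    (fun t : Γ(principalParts k M n, U) ↦ r • t) (h1 p)))

/-- The canonical map `dⁿ : M → 𝒫ⁿ_{X/k}(M)`, `m ↦ 1 ⊗ m`, on sections over `U`; it is
`k`-linear. -/
def dSections (M : X.Modules) (n : ℕ) (U : X.Opens) : Γ(M, U) →ₗ[k] Γ(principalParts k M n, U) where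
  toFun m := (toPrincipalParts k M n).app (op U) (ModulePrincipalParts.d k Γ(X, U) n Γ(M, U) m)
  map_add' m m' := by
    rw [map_add]; exact map_add ((toPrincipalParts k M n).app (op U)).hom _ _
  map_smul' c m := by
    have := toPrincipalParts_smul k M n U (fieldToSections k U c)
      (ModulePrincipalParts.d k Γ(X, U) n Γ(M, U) m)
    refine Eq.trans ?_ this
    congr 1
    exact ModulePrincipalParts.d_smul n c m

lemma map_dSections (M : X.Modules) (n : ℕ) {U W : X.Opens} (i : W ⟶ U) (m : Γ(M, U)) :
    (principalParts k M n).presheaf.map i.op (dSections k M n U m) =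
      dSections k M n W (M.presheaf.map i.op m) := by
  have h := congr($((toPrincipalParts k M n).naturality i.op)
    (ModulePrincipalParts.d k Γ(X, U) n Γ(M, U) m))
  refine Eq.trans h.symm ?_
  exact congrArg ((toPrincipalParts k M n).app (op W)) (ModulePrincipalParts.map_d n
    (resAlgHom k i) (M.presheaf.map i.op).hom (fun r m ↦ M.map_smul i r m) m)

end OverField

end AlgebraicGeometry.Scheme

/-! ### The sheaf of homomorphisms of two sheaves of modules -/

namespace AlgebraicGeometry.Scheme.Modules

variable {X : Scheme.{u}}

lemma map_map (F : X.Modules) {U W Z : X.Opens} (i : W ⟶ U) (j : Z ⟶ W) (m : Γ(F, U)) :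
    F.presheaf.map j.op (F.presheaf.map i.op m) = F.presheaf.map (j ≫ i).op m :=
  congr($(F.presheaf.map_comp i.op j.op) m).symm

lemma map_id_apply (F : X.Modules) {U : X.Opens} (i : U ⟶ U) (m : Γ(F, U)) :
    F.presheaf.map i.op m = m :=
  congr($(F.presheaf.map_id (op U)) m)

lemma ring_map_map {U W Z : X.Opens} (i : W ⟶ U) (j : Z ⟶ W) (r : Γ(X, U)) :
    X.presheaf.map j.op (X.presheaf.map i.op r) = X.presheaf.map (j ≫ i).op r :=
  congr($(X.presheaf.map_comp i.op j.op) r).symm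

lemma existsUnique_gluing (F : X.Modules) {ι : Type u} (U : ι → X.Opens) (V : X.Opens)
    (hU : ∀ i, U i ≤ V) (hV : V ≤ iSup U) (s : ∀ i, Γ(F, U i))
    (hs : ∀ i j, F.presheaf.map (homOfLE (inf_le_left : U i ⊓ U j ≤ U i)).op (s i) =
      F.presheaf.map (homOfLE (inf_le_right : U i ⊓ U j ≤ U j)).op (s j)) :
    ∃! t : Γ(F, V), ∀ i, F.presheaf.map (homOfLE (hU i)).op t = s i :=
  TopCat.Sheaf.existsUnique_gluing' (C := Ab.{u}) ⟨F.presheaf, F.isSheaf⟩ U V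
    (fun i ↦ homOfLE (hU i)) hV s hs

lemma eq_of_locally_eq (F : X.Modules) {ι : Type u} (U : ι → X.Opens) (V : X.Opens)
    (hU : ∀ i, U i ≤ V) (hV : V ≤ iSup U) (s t : Γ(F, V))
    (h : ∀ i, F.presheaf.map (homOfLE (hU i)).op s = F.presheaf.map (homOfLE (hU i)).op t) :
    s = t :=
  TopCat.Sheaf.eq_of_locally_eq' (C := Ab.{u}) ⟨F.presheaf, F.isSheaf⟩ U V
    (fun i ↦ homOfLE (hU i)) hV s t h

variable (F G : X.Modules)

/-- The group `Hom(F|_U, G|_U)` of `𝒪_U`-linear homomorphisms of sheaves: families of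
homomorphisms `Γ(F, W) → Γ(G, W)`, for `W ⊆ U`, which are `Γ(X, W)`-linear and compatible with
restrictions. -/
def localHomSubgroup (U : X.Opens) : 
    AddSubgroup (∀ W : {W : X.Opens // W ≤ U}, Γ(F, W.1) →+ Γ(G, W.1)) where
  carrier := {φ |
    (∀ (W : X.Opens) (h : W ≤ U) (r : Γ(X, W)) (m : Γ(F, W)), φ ⟨W, h⟩ (r • m) = r • φ ⟨W, h⟩ m) ∧
    (∀ (W Z : X.Opens) (h : W ≤ U) (i : Z ⟶ W) (m : Γ(F, W)),
      φ ⟨Z, i.le.trans h⟩ (F.presheaf.map i.op m) = G.presheaf.map i.op (φ ⟨W, h⟩ m))}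
  add_mem' := by
    rintro φ ψ ⟨h1, h2⟩ ⟨h3, h4⟩
    refine ⟨fun W h r m ↦ ?_, fun W Z h i m ↦ ?_⟩
    · simp only [Pi.add_apply, AddMonoidHom.add_apply, h1, h3, smul_add]
    · simp only [Pi.add_apply, AddMonoidHom.add_apply, h2 W Z h, h4 W Z h, map_add]
  zero_mem' := by
    refine ⟨fun W h r m ↦ ?_, fun W Z h i m ↦ ?_⟩ <;> simp
  neg_mem' := by
    rintro φ ⟨h1, h2⟩
    refine ⟨fun W h r m ↦ ?_, fun W Z h i m ↦ ?_⟩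
    · simp only [Pi.neg_apply, AddMonoidHom.neg_apply, h1, smul_neg]
    · simp only [Pi.neg_apply, AddMonoidHom.neg_apply, h2 W Z h, map_neg]

/-- The type of `𝒪_U`-linear homomorphisms `F|_U ⟶ G|_U`. -/
def LocalHom (U : X.Opens) : Type u := localHomSubgroup F G U

instance (U : X.Opens) : AddCommGroup (LocalHom F G U) :=
  inferInstanceAs (AddCommGroup (localHomSubgroup F G U))

namespace LocalHom

variable {F G} {U : X.Opens}

/-- The action of a local homomorphism on sections over `W ⊆ U`. -/
def app (P : LocalHom F G U) (W : X.Opens) (h : W ≤ U) : Γ(F, W) →+ Γ(G, W) := P.1 ⟨W, h⟩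

lemma map_smul (P : LocalHom F G U) {W : X.Opens} (h : W ≤ U) (r : Γ(X, W)) (m : Γ(F, W)) :
    P.app W h (r • m) = r • P.app W h m := P.2.1 W h r m

lemma map_res (P : LocalHom F G U) {W Z : X.Opens} (h : W ≤ U) (i : Z ⟶ W) (m : Γ(F, W)) :
    P.app Z (i.le.trans h) (F.presheaf.map i.op m) = G.presheaf.map i.op (P.app W h m) :=
  P.2.2 W Z h i m

@[ext]
lemma ext {P Q : LocalHom F G U} (H : ∀ (W : X.Opens) (h : W ≤ U) (m : Γ(F, W)),
    P.app W h m = Q.app W h m) : P = Q :=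
  Subtype.ext (funext fun W ↦ AddMonoidHom.ext (H W.1 W.2))

/-- Multiplication of a local homomorphism `P` by a function: `(r • P)(m) = r • P(m)`. -/
instance : SMul Γ(X, U) (LocalHom F G U) where
  smul r P := ⟨fun W ↦ AddMonoidHom.mk' (fun m ↦ X.presheaf.map (homOfLE W.2).op r • P.app W.1 W.2 m)
    (fun m m' ↦ by rw [map_add, smul_add]), by
      refine ⟨fun W h s m ↦ ?_, fun W Z h i m ↦ ?_⟩
      · simp only [AddMonoidHom.mk'_apply]
        rw [map_smul, smul_comm]
      · simp only [AddMonoidHom.mk'_apply]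
        rw [map_res P h, Modules.map_smul, ring_map_map]
        rfl⟩

lemma smul_apply (r : Γ(X, U)) (P : LocalHom F G U) {W : X.Opens} (h : W ≤ U) (m : Γ(F, W)) :
    (r • P).app W h m = X.presheaf.map (homOfLE h).op r • P.app W h m := rfl

lemma add_apply (P Q : LocalHom F G U) {W : X.Opens} (h : W ≤ U) (m : Γ(F, W)) :
    (P + Q).app W h m = P.app W h m + Q.app W h m := rfl

instance : Module Γ(X, U) (LocalHom F G U) where
  one_smul P := by ext W h m; rw [smul_apply, map_one, one_smul]
  mul_smul r s P := by ext W h m; simp only [smul_apply, map_mul, mul_smul]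
  smul_zero r := by ext W h m; exact smul_zero _
  smul_add r P Q := by ext W h m; simp only [smul_apply, add_apply, smul_add]
  add_smul r s P := by ext W h m; simp only [smul_apply, add_apply, map_add, add_smul]
  zero_smul P := by
    ext W h m
    rw [smul_apply, map_zero, zero_smul]
    rfl

/-- Restriction of local homomorphisms. -/
def res {U W : X.Opens} (i : W ⟶ U) : LocalHom F G U →+ LocalHom F G W where
  toFun P := ⟨fun Z ↦ P.app Z.1 (Z.2.trans i.le), fun Z h ↦ P.2.1 Z (h.trans i.le),
    fun Z Z' h ↦ P.2.2 Z Z' (h.trans i.le)⟩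
  map_zero' := rfl
  map_add' _ _ := rfl

lemma res_apply {U W : X.Opens} (i : W ⟶ U) (P : LocalHom F G U) {Z : X.Opens} (h : Z ≤ W)
    (m : Γ(F, Z)) : (res i P).app Z h m = P.app Z (h.trans i.le) m := rfl

lemma res_smul {U W : X.Opens} (i : W ⟶ U) (r : Γ(X, U)) (P : LocalHom F G U) :
    res i (r • P) = X.presheaf.map i.op r • res i P := by
  ext Z h m
  simp only [res_apply, smul_apply, ring_map_map]
  rfl

end LocalHom

/-- The presheaf of abelian groups `U ↦ Hom(F|_U, G|_U)`. -/
def sheafHomAb : TopCat.Presheaf Ab.{u} X where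
  obj U := AddCommGrpCat.of (LocalHom F G U.unop)
  map i := AddCommGrpCat.ofHom (LocalHom.res i.unop)
  map_id _ := rfl
  map_comp _ _ := rfl

lemma sheafHomAb_isSheaf : (sheafHomAb F G).IsSheaf := by
  rw [TopCat.Presheaf.isSheaf_iff_isSheafUniqueGluing]
  intro ι U sf hsf
  let s : ∀ i, LocalHom F G (U i) := sf
  have hs : ∀ (i j : ι) (W : X.Opens) (hi : W ≤ U i) (hj : W ≤ U j) (m : Γ(F, W)),
      (s i).app W hi m = (s j).app W hj m := by
    intro i j W hi hj m
    exact congr(($(hsf i j) : LocalHom F G (U i ⊓ U j)).app W (le_inf hi hj) m)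
  have key : ∀ (W : X.Opens) (_ : W ≤ iSup U) (m : Γ(F, W)),
      ∃! t : Γ(G, W), ∀ i, G.presheaf.map (homOfLE (inf_le_left : W ⊓ U i ≤ W)).op t =
        (s i).app (W ⊓ U i) inf_le_right
          (F.presheaf.map (homOfLE (inf_le_left : W ⊓ U i ≤ W)).op m) := by
    intro W hW m
    refine G.existsUnique_gluing (fun i ↦ W ⊓ U i) W (fun i ↦ inf_le_left) ?_ _ ?_
    · rw [← inf_iSup_eq]; exact le_inf le_rfl hW
    · intro i j
      rw [← LocalHom.map_res, ← LocalHom.map_res, map_map, map_map]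
      exact hs i j _ _ _ _
  choose g hg hg' using key
  have huniq : ∀ (W : X.Opens) (hW : W ≤ iSup U) (m : Γ(F, W)) (t : Γ(G, W)),
      (∀ i, G.presheaf.map (homOfLE (inf_le_left : W ⊓ U i ≤ W)).op t =
        (s i).app (W ⊓ U i) inf_le_right
          (F.presheaf.map (homOfLE (inf_le_left : W ⊓ U i ≤ W)).op m)) → t = g W hW m :=
    fun W hW m t ht ↦ hg' W hW m t ht
  let P : LocalHom F G (iSup U) := ⟨fun W ↦ AddMonoidHom.mk' (g W.1 W.2) (fun m m' ↦ by
      refine (huniq W.1 W.2 _ _ fun i ↦ ?_).symm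
      rw [map_add, hg, hg, map_add, map_add]), by
    refine ⟨fun W hW r m ↦ ?_, fun W Z hW j m ↦ ?_⟩
    · refine (huniq W hW _ _ fun i ↦ ?_).symm
      simp only [AddMonoidHom.mk'_apply]
      rw [Modules.map_smul, hg, Modules.map_smul, LocalHom.map_smul]
    · refine (huniq Z (j.le.trans hW) _ _ fun i ↦ ?_).symm
      simp only [AddMonoidHom.mk'_apply]
      have e := congrArg (G.presheaf.map
        (homOfLE (inf_le_inf_right (U i) j.le : Z ⊓ U i ≤ W ⊓ U i)).op) (hg W hW m i)
      rw [← LocalHom.map_res, map_map, map_map] at e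
      rw [map_map, map_map]
      exact e⟩
  refine ⟨P, fun i ↦ ?_, fun Q hQ ↦ ?_⟩
  · refine LocalHom.ext (P := LocalHom.res (Opens.leSupr U i) P) (Q := s i) fun W hW m ↦ ?_
    refine (huniq W _ m _ fun j ↦ ?_).symm
    rw [← LocalHom.map_res]
    exact hs i j _ _ _ _
  · refine LocalHom.ext (P := Q) (Q := P) fun W hW m ↦ huniq W hW m _ fun i ↦ ?_
    have := congr(($(hQ i) : LocalHom F G (U i)).app (W ⊓ U i) inf_le_right
      (F.presheaf.map (homOfLE (inf_le_left : W ⊓ U i ≤ W)).op m))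
    rw [← LocalHom.map_res (Q : LocalHom F G (iSup U))]
    exact this

instance (U : X.Opensᵒᵖ) : Module (X.ringCatSheaf.obj.obj U) ((sheafHomAb F G).obj U) :=
  inferInstanceAs (Module Γ(X, U.unop) (LocalHom F G U.unop))

/-- The `𝒪_X`-module `ℋom(F, G)` of homomorphisms of two `𝒪_X`-modules, with sections
`Hom(F|_U, G|_U)` over `U`. -/
def sheafHom : X.Modules where
  val := PresheafOfModules.ofPresheaf (sheafHomAb F G)
    (fun _ _ i r P ↦ LocalHom.res_smul i.unop r P)
  isSheaf := sheafHomAb_isSheaf F G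

end AlgebraicGeometry.Scheme.Modules

/-! ### Differential operators and their action on a space of sections -/

namespace AlgebraicGeometry.Scheme

section OverField

variable (k : Type u) [Field k] {X : Scheme.{u}} [X.Over (Spec (CommRingCat.of k))]

/-- The `𝒪_X`-module `𝒟ⁿ_{X/k}(M) = ℋom(𝒫ⁿ_{X/k}(M), M)` of differential operators of order at
most `n` on `M`. -/
def diffOps (M : X.Modules) (n : ℕ) : X.Modules :=
  (principalParts k M n).sheafHom M

/-- The action `P · m = P(dⁿ m)` of a local differential operator on sections. -/
def act (M : X.Modules) (n : ℕ) {U : X.Opens} (P : (principalParts k M n).LocalHom M U) :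
    Γ(M, U) →ₗ[k] Γ(M, U) where
  toFun m := P.app U le_rfl (dSections k M n U m)
  map_add' m m' := by rw [map_add, map_add]
  map_smul' c m := by
    rw [map_smul]
    exact P.map_smul le_rfl (fieldToSections k U c) (dSections k M n U m)

lemma act_add (M : X.Modules) (n : ℕ) {U : X.Opens}
    (P Q : (principalParts k M n).LocalHom M U) (m : Γ(M, U)) :
    act k M n (P + Q) m = act k M n P m + act k M n Q m := rfl

lemma act_smul (M : X.Modules) (n : ℕ) {U : X.Opens} (r : Γ(X, U))
    (P : (principalParts k M n).LocalHom M U) (m : Γ(M, U)) :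
    act k M n (r • P) m = r • act k M n P m := by
  have h : X.presheaf.map (homOfLE (le_refl U)).op r = r := congr($(X.presheaf.map_id (op U)) r)
  refine (Modules.LocalHom.smul_apply r P le_rfl _).trans ?_
  rw [h]; rfl

lemma res_act (M : X.Modules) (n : ℕ) {U W : X.Opens} (i : W ⟶ U)
    (P : (principalParts k M n).LocalHom M U) (m : Γ(M, U)) :
    M.presheaf.map i.op (act k M n P m) =
      act k M n (Modules.LocalHom.res i P) (M.presheaf.map i.op m) := by
  refine (P.map_res le_rfl i _).symm.trans ?_
  rw [map_dSections]; rfl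

section Evaluation

variable {k} {M : X.Modules} (V : Submodule k Γ(M, ⊤)) (n : ℕ)

/-- The restriction to `U` of the sections in `V`. -/
def resTop (U : X.Opens) : V →ₗ[k] Γ(M, U) := (M.resₗ k (homOfLE le_top)).comp V.subtype

lemma map_resTop {U W : X.Opens} (i : W ⟶ U) (v : V) :
    M.presheaf.map i.op (resTop V U v) = resTop V W v :=
  M.map_map _ _ _

/-- The evaluation of a local differential operator on `V`, as a `k`-linear map
`V → Γ(M, U)`, `v ↦ P · v`. -/
def evalOn {U : X.Opens} (P : (principalParts k M n).LocalHom M U) : V →ₗ[k] Γ(M, U) :=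
  (act k M n P).comp (resTop V U)

/-- The sections over `U` of `Annⁿ V`: the differential operators `P` of order at most `n`
over `U` with `P · V = 0`. -/
def annSections (U : X.Opens) :
    Submodule Γ(X, U) ((principalParts k M n).LocalHom M U) where
  carrier := {P | ∀ v : V, act k M n P (resTop V U v) = 0}
  add_mem' h h' v := by rw [act_add, h v, h' v, add_zero]
  zero_mem' _ := rfl
  smul_mem' r P h v := by rw [act_smul, h v, smul_zero]

/-- Restriction of sections of `Annⁿ V`. -/
def annRes {U W : X.Opens} (i : W ⟶ U) : annSections V n U →+ annSections V n W where
  toFun P := ⟨Modules.LocalHom.res i P.1, fun v ↦ by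
    rw [← map_resTop V i, ← res_act, P.2 v, map_zero]⟩
  map_zero' := rfl
  map_add' _ _ := rfl

/-- The presheaf of abelian groups underlying `Annⁿ V`. -/
def annAb : TopCat.Presheaf Ab.{u} X where
  obj U := AddCommGrpCat.of (annSections V n U.unop)
  map i := AddCommGrpCat.ofHom (annRes V n i.unop)
  map_id _ := rfl
  map_comp _ _ := rfl

lemma annAb_isSheaf : (annAb V n).IsSheaf := by
  rw [TopCat.Presheaf.isSheaf_iff_isSheafUniqueGluing]
  intro ι U sf hsf
  let s : ∀ i, annSections V n (U i) := sf
  obtain ⟨P', hP, hP'⟩ := (TopCat.Presheaf.isSheaf_iff_isSheafUniqueGluing _).1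
    (Modules.sheafHomAb_isSheaf (principalParts k M n) M) U (fun i ↦ (s i).1)
    (fun i j ↦ congrArg Subtype.val (hsf i j))
  let P : (principalParts k M n).LocalHom M (iSup U) := P'
  have hPs : ∀ i, Modules.LocalHom.res (Opens.leSupr U i) P = (s i).1 := hP
  have hPV : ∀ v : V, act k M n P (resTop V (iSup U) v) = 0 := fun v ↦ by
    refine M.eq_of_locally_eq U (iSup U) (le_iSup U) le_rfl _ _ fun i ↦ ?_
    rw [res_act, map_resTop, map_zero]
    have := (s i).2 v
    rw [← hPs] at this
    exact this
  refine ⟨⟨P, hPV⟩, fun i ↦ Subtype.ext (hP i), fun Q hQ ↦ Subtype.ext ?_⟩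
  exact hP' _ fun i ↦ congrArg Subtype.val (hQ i)

instance (U : X.Opensᵒᵖ) : Module (X.ringCatSheaf.obj.obj U) ((annAb V n).obj U) :=
  inferInstanceAs (Module Γ(X, U.unop) (annSections V n U.unop))

/-- The `𝒪_X`-submodule `Annⁿ V = {P ∈ 𝒟ⁿ_{X/k}(M) | P · V = 0}` of `𝒟ⁿ_{X/k}(M)`. -/
def ann : X.Modules where
  val := PresheafOfModules.ofPresheaf (annAb V n)
    (fun _ _ i r P ↦ Subtype.ext (Modules.LocalHom.res_smul i.unop r P.1))
  isSheaf := annAb_isSheaf V n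

/-- The inclusion `Annⁿ V ⟶ 𝒟ⁿ_{X/k}(M)`. -/
def annι : ann V n ⟶ diffOps k M n :=
  ⟨PresheafOfModules.homMk
    { app := fun U ↦ AddCommGrpCat.ofHom (annSections V n U.unop).subtype.toAddMonoidHom }
    (fun _ _ _ ↦ rfl)⟩

/-- The sections over `U` of `V^* ⊗[k] M`. -/
def DualTensor (U : X.Opens) : Type u := Module.Dual k V ⊗[k] Γ(M, U)

namespace DualTensor

instance (U : X.Opens) : AddCommGroup (DualTensor V U) :=
  inferInstanceAs (AddCommGroup (Module.Dual k V ⊗[k] Γ(M, U)))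

instance (U : X.Opens) : Module k (DualTensor V U) :=
  inferInstanceAs (Module k (Module.Dual k V ⊗[k] Γ(M, U)))

/-- Functions act on `V^* ⊗[k] M` through the second factor: `r • (f ⊗ m) = f ⊗ (r • m)`. -/
instance (U : X.Opens) : Module Γ(X, U) (DualTensor V U) :=
  Module.compHom (Module.Dual k V ⊗[k] Γ(M, U))
    ((Module.End.lTensorAlgHom k Γ(M, U) (Module.Dual k V)).toRingHom.comp
      (Algebra.lsmul k k Γ(M, U)).toRingHom)

/-- The canonical map `V^* ⊗[k] M → Hom_k(V, M)`. -/
def toHom (U : X.Opens) : DualTensor V U →ₗ[k] V →ₗ[k] Γ(M, U) := dualTensorHom k V Γ(M, U)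

/-- The pure tensor `f ⊗ m`. -/
def tmul {U : X.Opens} (f : Module.Dual k V) (m : Γ(M, U)) : DualTensor V U := f ⊗ₜ[k] m

@[elab_as_elim]
lemma induction_on {U : X.Opens} {P : DualTensor V U → Prop} (t : DualTensor V U)
    (zero : P 0) (tmul : ∀ f m, P (tmul V f m)) (add : ∀ x y, P x → P y → P (x + y)) : P t :=
  TensorProduct.induction_on t zero tmul add

lemma toHom_tmul {U : X.Opens} (f : Module.Dual k V) (m : Γ(M, U)) (v : V) :
    toHom V U (tmul V f m) v = f v • m := rfl

lemma smul_tmul {U : X.Opens} (r : Γ(X, U)) (f : Module.Dual k V) (m : Γ(M, U)) :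
    r • tmul V f m = tmul V f (r • m) := rfl

lemma toHom_smul {U : X.Opens} (r : Γ(X, U)) (t : DualTensor V U) (v : V) :
    toHom V U (r • t) v = r • toHom V U t v := by
  induction t using induction_on with
  | zero => simp only [smul_zero, map_zero, LinearMap.zero_apply]
  | tmul f m => rw [smul_tmul, toHom_tmul, toHom_tmul, smul_comm]
  | add x y hx hy => simp only [smul_add, map_add, LinearMap.add_apply, hx, hy]

/-- Restriction of sections of `V^* ⊗[k] M`. -/
def res {U W : X.Opens} (i : W ⟶ U) : DualTensor V U →ₗ[k] DualTensor V W :=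
  (M.resₗ k i).lTensor (Module.Dual k V)

lemma toHom_res {U W : X.Opens} (i : W ⟶ U) (t : DualTensor V U) (v : V) :
    toHom V W (res V i t) v = M.presheaf.map i.op (toHom V U t v) := by
  induction t using induction_on with
  | zero => simp only [map_zero, LinearMap.zero_apply]
  | tmul f m => exact ((M.resₗ k i).map_smul (f v) m).symm
  | add x y hx hy => simp only [map_add, LinearMap.add_apply, hx, hy]

lemma res_id {U : X.Opens} (t : DualTensor V U) : res V (𝟙 U) t = t := by
  have h : M.resₗ k (𝟙 U) = LinearMap.id := LinearMap.ext fun m ↦ M.map_id_apply (𝟙 _) m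
  rw [res, h, LinearMap.lTensor_id]; rfl

lemma res_comp {U W Z : X.Opens} (i : W ⟶ U) (j : Z ⟶ W) (t : DualTensor V U) :
    res V (j ≫ i) t = res V j (res V i t) := by
  have h : M.resₗ k (j ≫ i) = (M.resₗ k j).comp (M.resₗ k i) :=
    LinearMap.ext fun m ↦ (M.map_map i j m).symm
  rw [res, h, LinearMap.lTensor_comp]; rfl

variable [FiniteDimensional k V]

lemma toHom_bijective (U : X.Opens) : Function.Bijective (toHom V U) := dualTensorHom_bijective

/-- The isomorphism `V^* ⊗[k] M ≃ Hom_k(V, M)`. -/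
def equivHom (U : X.Opens) : DualTensor V U ≃ₗ[k] (V →ₗ[k] Γ(M, U)) :=
  LinearEquiv.ofBijective (toHom V U) (toHom_bijective V U)

lemma ext {U : X.Opens} {s t : DualTensor V U} (h : ∀ v, toHom V U s v = toHom V U t v) : s = t :=
  (toHom_bijective V U).1 (LinearMap.ext h)

lemma toHom_equivHom_symm {U : X.Opens} (f : V →ₗ[k] Γ(M, U)) :
    toHom V U ((equivHom V U).symm f) = f := (equivHom V U).apply_symm_apply f

end DualTensor

/-- The presheaf of abelian groups `U ↦ V^* ⊗[k] Γ(M, U)`. -/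
def dualTensorAb : TopCat.Presheaf Ab.{u} X where
  obj U := AddCommGrpCat.of (DualTensor V U.unop)
  map i := AddCommGrpCat.ofHom (DualTensor.res V i.unop).toAddMonoidHom
  map_id U := by ext t; exact DualTensor.res_id V t
  map_comp i j := by ext t; exact DualTensor.res_comp V i.unop j.unop t

variable [FiniteDimensional k V]

lemma dualTensorAb_isSheaf : (dualTensorAb V).IsSheaf := by
  rw [TopCat.Presheaf.isSheaf_iff_isSheafUniqueGluing]
  intro ι U sf hsf
  let s : ∀ i, DualTensor V (U i) := sf
  have key : ∀ v : V, ∃! t : Γ(M, iSup U), ∀ i,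
      M.presheaf.map (homOfLE (le_iSup U i)).op t = DualTensor.toHom V (U i) (s i) v := by
    intro v
    refine M.existsUnique_gluing U _ (le_iSup U) le_rfl _ fun i j ↦ ?_
    rw [← DualTensor.toHom_res, ← DualTensor.toHom_res]
    exact congr(DualTensor.toHom V (U i ⊓ U j) $(hsf i j) v)
  choose g hg hg' using key
  let G : V →ₗ[k] Γ(M, iSup U) :=
    { toFun := g
      map_add' := fun v w ↦ (hg' _ _ fun i ↦ by rw [map_add, map_add, hg, hg]).symm
      map_smul' := fun c v ↦ (hg' _ _ fun i ↦ by
        have := (M.resₗ k (homOfLE (le_iSup U i))).map_smul c (g v)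
        simp only [Modules.resₗ_apply] at this
        rw [RingHom.id_apply, this, map_smul, hg]).symm }
  refine ⟨(DualTensor.equivHom V _).symm G, fun i ↦ ?_, fun t ht ↦ ?_⟩
  · refine DualTensor.ext V (s := DualTensor.res V (Opens.leSupr U i) _) (t := s i) fun v ↦ ?_
    rw [DualTensor.toHom_res, DualTensor.toHom_equivHom_symm]
    exact hg v i
  · let t' : DualTensor V (iSup U) := t
    refine DualTensor.ext V (s := t') fun v ↦ ?_
    rw [DualTensor.toHom_equivHom_symm]
    refine hg' v _ fun i ↦ ?_
    rw [← DualTensor.toHom_res]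
    exact congr(DualTensor.toHom V (U i) $(ht i) v)

instance (U : X.Opensᵒᵖ) : Module (X.ringCatSheaf.obj.obj U) ((dualTensorAb V).obj U) :=
  inferInstanceAs (Module Γ(X, U.unop) (DualTensor V U.unop))

lemma DualTensor.res_smul {U W : X.Opens} (i : W ⟶ U) (r : Γ(X, U)) (t : DualTensor V U) :
    DualTensor.res V i (r • t) = X.presheaf.map i.op r • DualTensor.res V i t := by
  refine DualTensor.ext V fun v ↦ ?_
  rw [toHom_res, toHom_smul, toHom_smul, Modules.map_smul, toHom_res]

/-- The `𝒪_X`-module `V^* ⊗[k] M`, with sections `V^* ⊗[k] Γ(M, U)` over `U`. -/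
def dualTensor : X.Modules where
  val := PresheafOfModules.ofPresheaf (dualTensorAb V)
    (fun _ _ i r t ↦ DualTensor.res_smul V i.unop r t)
  isSheaf := dualTensorAb_isSheaf V

/-- The map `𝒟ⁿ_{X/k}(M) → V^* ⊗[k] M` on sections over `U`: it takes `P` to the element
corresponding to the `k`-linear map `v ↦ P · v` under `V^* ⊗[k] M = Hom_k(V, M)`. -/
def evalSections (U : X.Opens) :
    (principalParts k M n).LocalHom M U →+ DualTensor V U where
  toFun P := (DualTensor.equivHom V U).symm (evalOn V n P)
  map_zero' := by rw [← map_zero (DualTensor.equivHom V U).symm]; rfl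
  map_add' P Q := by rw [← map_add]; rfl

lemma toHom_evalSections {U : X.Opens} (P : (principalParts k M n).LocalHom M U) (v : V) :
    DualTensor.toHom V U (evalSections V n U P) v = act k M n P (resTop V U v) :=
  congr($(DualTensor.toHom_equivHom_symm V (evalOn V n P)) v)

/-- The evaluation map `Wⁿ : 𝒟ⁿ_{X/k}(M) ⟶ V^* ⊗[k] M`. -/
def evalMap : diffOps k M n ⟶ dualTensor V :=
  ⟨PresheafOfModules.homMk
    { app := fun U ↦ AddCommGrpCat.ofHom (evalSections V n U.unop)
      naturality := fun U W i ↦ by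
        ext P
        let P' : (principalParts k M n).LocalHom M U.unop := P
        refine DualTensor.ext V (s := evalSections V n W.unop (Modules.LocalHom.res i.unop P'))
          (t := DualTensor.res V i.unop (evalSections V n U.unop P')) fun v ↦ ?_
        rw [toHom_evalSections, DualTensor.toHom_res, toHom_evalSections, res_act, map_resTop] }
    (fun U r P ↦ by
      let r' : Γ(X, U.unop) := r
      let P' : (principalParts k M n).LocalHom M U.unop := P
      refine DualTensor.ext V (s := evalSections V n U.unop (r' • P'))
          (t := r' • evalSections V n U.unop P') fun v ↦ ?_
      rw [toHom_evalSections, DualTensor.toHom_smul, toHom_evalSections, act_smul])⟩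

/-- The sequence `0 → Annⁿ V → 𝒟ⁿ_{X/k}(M) → V^* ⊗[k] M → 0` of `𝒪_X`-modules. -/
def evalSequence : ShortComplex X.Modules where
  X₁ := ann V n
  X₂ := diffOps k M n
  X₃ := dualTensor V
  f := annι V n
  g := evalMap V n
  zero := by
    apply Modules.hom_ext
    intro U
    ext P
    refine DualTensor.ext V (s := evalSections V n U (P : annSections V n U).1) (t := 0) fun v ↦ ?_
    rw [toHom_evalSections, map_zero]
    exact (P : annSections V n U).2 v

end Evaluation

end OverField

end AlgebraicGeometry.Scheme

/-! ### Fibres of the Taylor map, separated subspaces, injectivity order -/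

namespace AlgebraicGeometry.Scheme

section Fibre

variable {X : Scheme.{u}}

instance moduleStalk (F : X.Modules) (x : X) :
    Module (X.presheaf.stalk x) (F.presheaf.stalk x) :=
  let F' : _root_.PresheafOfModules.{u} (X.presheaf ⋙ forget₂ CommRingCat RingCat) := F.val
  inferInstanceAs (Module (X.presheaf.stalk x) ↑(TopCat.Presheaf.stalk F'.presheaf x))

instance algebraStalkResidueField (x : X) : Algebra (X.presheaf.stalk x) (X.residueField x) :=
  (X.residue x).hom.toAlgebra

/-- The germ at `x` of a section of an `𝒪_X`-module. -/
def Modules.germ (F : X.Modules) (U : X.Opens) (x : X) (hx : x ∈ U) :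
    Γ(F, U) →+ F.presheaf.stalk x := (TopCat.Presheaf.germ F.presheaf U x hx).hom

lemma Modules.germ_smul (F : X.Modules) (U : X.Opens) (x : X) (hx : x ∈ U) (r : Γ(X, U))
    (m : Γ(F, U)) : F.germ U x hx (r • m) = X.presheaf.germ U x hx r • F.germ U x hx m :=
  PresheafOfModules.germ_smul (R := X.presheaf) F.val x U hx r m

/-- The fibre `k_x ⊗_{𝒪_{X,x}} F_x` of an `𝒪_X`-module `F` at a point `x`. -/
def Modules.fibre (F : X.Modules) (x : X) : Type u :=
  X.residueField x ⊗[X.presheaf.stalk x] F.presheaf.stalk x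

instance (F : X.Modules) (x : X) : AddCommGroup (F.fibre x) :=
  inferInstanceAs (AddCommGroup (X.residueField x ⊗[X.presheaf.stalk x] F.presheaf.stalk x))

instance (F : X.Modules) (x : X) : Module (X.residueField x) (F.fibre x) :=
  inferInstanceAs (Module (X.residueField x)
    (X.residueField x ⊗[X.presheaf.stalk x] F.presheaf.stalk x))

variable (k : Type u) [Field k] [X.Over (Spec (CommRingCat.of k))]

instance algebraResidueField (x : X) : Algebra k (X.residueField x) :=
  ((X.residue x).hom.comp ((X.presheaf.germ ⊤ x trivial).hom.comp (fieldToSections k ⊤))).toAlgebra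

instance moduleFibre (F : X.Modules) (x : X) : Module k (F.fibre x) :=
  Module.compHom _ (algebraMap k (X.residueField x))

instance isScalarTowerFibre (F : X.Modules) (x : X) :
    IsScalarTower k (X.residueField x) (F.fibre x) :=
  ⟨fun c r m ↦ by rw [Algebra.smul_def, mul_smul]; rfl⟩

/-- The value at `x`, in the fibre of `F`, of a global section of an `𝒪_X`-module `F`. -/
def Modules.value (F : X.Modules) (x : X) : Γ(F, ⊤) →ₗ[k] F.fibre x where
  toFun m := (1 : X.residueField x) ⊗ₜ[X.presheaf.stalk x] F.germ ⊤ x trivial m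
  map_add' m m' := by rw [map_add]; exact TensorProduct.tmul_add _ _ _
  map_smul' c m := by
    have h : F.germ ⊤ x trivial (c • m) =
        X.presheaf.germ ⊤ x trivial (fieldToSections k ⊤ c) • F.germ ⊤ x trivial m :=
      F.germ_smul ⊤ x trivial _ m
    rw [h, ← TensorProduct.smul_tmul, Algebra.smul_def, mul_one, RingHom.id_apply]
    refine Eq.trans ?_ (TensorProduct.smul_tmul' (algebraMap k (X.residueField x) c) 1
      (F.germ ⊤ x trivial m)).symm
    rw [smul_eq_mul, mul_one]
    rfl

variable {k} {M : X.Modules} (V : Submodule k Γ(M, ⊤))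

/-- The map of fibres `dⁿ_V(x) : k_x ⊗[k] V → k_x ⊗ 𝒫ⁿ_{X/k}(M)_x`, `c ⊗ v ↦ c ⊗ dⁿ(v)_x`, of the
Taylor map at a point `x`. -/
def taylorFibre (n : ℕ) (x : X) :
    X.residueField x ⊗[k] V →ₗ[X.residueField x] (principalParts k M n).fibre x :=
  LinearMap.liftBaseChange (X.residueField x)
    (((principalParts k M n).value k x).comp ((dSections k M n ⊤).comp V.subtype))

/-- `V` is separated at `x` if the maps of fibres of the Taylor map at `x` are injective for all
sufficiently large `n`. -/
def IsSeparatedAt (x : X) : Prop :=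
  ∃ N : ℕ, ∀ n : ℕ, N ≤ n → Function.Injective (taylorFibre V n x)

/-- `V` is separated if it is separated at every point. -/
def IsSeparatedSubspace : Prop := ∀ x : X, IsSeparatedAt V x

/-- The injectivity order of `V` at `x`: the smallest `n` such that `dⁿ_V(x)` is injective
(and `⊤` if there is none). -/
def injOrderAt (x : X) : ℕ∞ :=
  ⨅ n ∈ {n : ℕ | Function.Injective (taylorFibre V n x)}, (n : ℕ∞)

/-- The injectivity order `n_inj(V)` of `V`: the supremum of the injectivity orders at the points
of `X`. -/
def injOrder : ℕ∞ := ⨆ x : X, injOrderAt V x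

end Fibre

/-- An `𝒪_X`-module is locally free of finite rank if it is locally isomorphic to `𝒪_X ^ r`. -/
def Modules.IsLocallyFreeOfFiniteRank {X : Scheme.{u}} (M : X.Modules) : Prop :=
  ∀ x : X, ∃ U : X.Opens, x ∈ U ∧ ∃ r : ℕ,
    Nonempty (M.restrict U.ι ≅
      (SheafOfModules.free (R := U.toScheme.ringCatSheaf) (ULift.{u} (Fin r)) : U.toScheme.Modules))

instance {X Y : Scheme.{u}} (f : X ⟶ Y) [IsOpenImmersion f] :
    (Modules.restrictFunctor f).PreservesZeroMorphisms where
  map_zero _ _ := rfl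

/-- A sequence of `𝒪_X`-modules is locally split if every point of `X` has an open neighbourhood
`U` such that the restriction of the sequence to `U` is a split sequence of `𝒪_U`-modules. -/
def Modules.IsLocallySplit {X : Scheme.{u}} (S : ShortComplex X.Modules) : Prop :=
  ∀ x : X, ∃ U : X.Opens, x ∈ U ∧ Nonempty (S.map (Modules.restrictFunctor U.ι)).Splitting

end AlgebraicGeometry.Scheme

end

/-! Left exactness is formal: `Annⁿ V` is the kernel of `Wⁿ` on every open set. The content is that
`Wⁿ` has an `𝒪`-linear section near each point `x`, which gives surjectivity and the local splitting
at once.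

Suppose that `𝒫ⁿ(M)` is free near `x` with frame `β_j`. Expand the Taylor series of a basis `b_i` of
`V` as `dⁿ b_i = ∑ A_ij β_j`. Injectivity of the fibre map at `x` says that the rows of `A(x)` are
linearly independent, so `A(x)` has a right inverse over the residue field. Lifting it and dividing
by a determinant gives a matrix `C` of functions with `A C = 1` near `x`. The operator sending `β_j`
to `∑ C_ji t(b_i)` then takes each `b_i` to `t(b_i)`, and it depends linearly on `t`. The
injectivity order supplies injectivity in some order `m ≤ n`; truncation `𝒫ⁿ → 𝒫ᵐ` carries a
relation between the rows of `A(x)` down to order `m`.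

Freeness of `𝒫ⁿ(M)` uses regularity and characteristic zero. A regular point over a perfect field is
smooth (`IsRegularLocalRing.formallySmooth_of_surjective`, which rests on
`IsRegularLocalRing.inf_maximalIdeal_sq_le`), so near it `Ω` has a basis of exact differentials
`df_i`. The monomials of degree at most `n` in `1 ⊗ f_i - f_i ⊗ 1` are then a basis of the principal
parts (`ModulePrincipalParts.exists_basis`). They span because `I/I² = Ω`. They are independent
because the derivations dual to the `df_i` act on them as partial derivatives, and in characteristic
zero a polynomial with vanishing partial derivatives is constant.

Since `𝒫ⁿ(M)` is a sheafification, a frame is known only as a presheaf basis on a base of open sets;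
`IsLocalFrame.exists_localHom_app_eq` and `IsLocalFrame.localHom_ext` show that this suffices to
define homomorphisms and to compare them. -/

/-! ### Regular local rings -/

namespace IsLocalRing

variable {R : Type*} [CommRing R] [IsLocalRing R] [IsNoetherianRing R]

/-- An element of `m ∖ m²` is part of a minimal system of generators of the maximal ideal `m`. -/
theorem exists_maximalIdeal_eq_span_insert {f : R} (hf : f ∈ maximalIdeal R)
    (hf2 : f ∉ maximalIdeal R ^ 2) :
    ∃ t : Finset R, maximalIdeal R = Ideal.span (insert f (t : Set R)) ∧
      t.card + 1 = (maximalIdeal R).spanFinrank := by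
  classical
  -- The class of `f` in `m/m²` is nonzero, so it extends to a basis; by Nakayama, lifts of the
  -- other basis vectors generate `m` together with `f`.
  let c : CotangentSpace R := (maximalIdeal R).toCotangent ⟨f, hf⟩
  have hc : c ≠ 0 := fun h ↦ hf2 ((Ideal.toCotangent_eq_zero _ ⟨f, hf⟩).1 h)
  have hli : LinearIndepOn (ResidueField R) id ({c} : Set (CotangentSpace R)) :=
    LinearIndepOn.singleton hc
  let b := Module.Basis.extend hli
  have hcmem : c ∈ hli.extend (Set.subset_univ _) := hli.subset_extend _ rfl
  have : Fintype (hli.extend (Set.subset_univ {c})) :=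
    Module.Basis.fintypeIndexOfRankLtAleph0 b (Module.rank_lt_aleph0 _ _)
  obtain ⟨g, hg⟩ : ∃ g : CotangentSpace R → maximalIdeal R,
      ∀ y, (maximalIdeal R).toCotangent (g y) = y :=
    ⟨_, Function.surjInv_eq (Ideal.toCotangent_surjective _)⟩
  let E : Finset (CotangentSpace R) := (hli.extend (Set.subset_univ {c})).toFinset
  have hcE : c ∈ E := by simpa [E] using hcmem
  have hEspan : Submodule.span (ResidueField R) (E : Set (CotangentSpace R)) = ⊤ := by
    have := b.span_eq
    rw [Module.Basis.range_extend] at this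
    simpa [E] using this
  have hcard : E.card = (maximalIdeal R).spanFinrank := by
    rw [spanFinrank_maximalIdeal_eq_finrank_cotangentSpace, Module.finrank_eq_card_basis b]
    simp [E]
  let s : Set (maximalIdeal R) := insert ⟨f, hf⟩ (g '' (E.erase c : Finset _))
  have hs : Submodule.span R s = ⊤ := by
    rw [← CotangentSpace.span_image_eq_top_iff, ← top_le_iff, ← hEspan]
    refine Submodule.span_mono fun y hy ↦ ?_
    by_cases hyc : y = c
    · exact ⟨_, Set.mem_insert _ _, hyc.symm⟩
    · exact ⟨g y, Set.mem_insert_of_mem _ ⟨y, by simpa [hyc] using hy, rfl⟩, hg y⟩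
  have hinj : Function.Injective fun y ↦ (g y : R) :=
    Subtype.val_injective.comp (Function.LeftInverse.injective hg)
  refine ⟨(E.erase c).image fun y ↦ (g y : R), ?_, ?_⟩
  · have := congrArg (Submodule.map (maximalIdeal R).subtype) hs
    rw [Submodule.map_span, Submodule.map_top, Submodule.range_subtype] at this
    refine this.symm.trans ?_
    congr 1
    simp [s, Set.image_insert_eq, Set.image_image]
  · rw [Finset.card_image_of_injective _ hinj, Finset.card_erase_add_one hcE, hcard]

/-- Lifts of generators of the maximal ideal of `R ⧸ I` generate `m` modulo `I ⊆ m²`, hence generate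
`m` by Nakayama. -/
theorem spanFinrank_maximalIdeal_le_quotient {I : Ideal R} [IsLocalRing (R ⧸ I)]
    (hI : I ≤ maximalIdeal R ^ 2) :
    (maximalIdeal R).spanFinrank ≤ (maximalIdeal (R ⧸ I)).spanFinrank := by
  classical
  have hfg : (maximalIdeal (R ⧸ I)).FG := IsNoetherian.noetherian _
  let G := (maximalIdeal (R ⧸ I)).generators
  have hG : G.Finite := Submodule.FG.finite_generators hfg
  obtain ⟨g, hg⟩ : ∃ g : R ⧸ I → R, ∀ y, Ideal.Quotient.mk I (g y) = y :=
    ⟨_, Function.surjInv_eq Ideal.Quotient.mk_surjective⟩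
  have hmap := IsLocalRing.map_maximalIdeal_of_surjective (Ideal.Quotient.mk I)
    Ideal.Quotient.mk_surjective
  have hspan : Ideal.map (Ideal.Quotient.mk I) (Ideal.span (g '' G)) =
      maximalIdeal (R ⧸ I) := by
    rw [Ideal.map_span, Set.image_image]
    simp only [hg, Set.image_id']
    exact Submodule.span_generators _
  have hIm : I ≤ maximalIdeal R := hI.trans (Ideal.pow_le_self two_ne_zero)
  have hle : Ideal.span (g '' G) ≤ maximalIdeal R := by
    have : Ideal.map (Ideal.Quotient.mk I) (Ideal.span (g '' G)) ≤
      Ideal.map (Ideal.Quotient.mk I) (maximalIdeal R) := by rw [hspan, hmap]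
    intro y hy
    have := this (Ideal.mem_map_of_mem _ hy)
    rw [Ideal.mem_quotient_iff_mem_sup, sup_eq_left.2 hIm] at this
    exact this
  have heq : maximalIdeal R ≤ Ideal.span (g '' G) := by
    refine Submodule.le_of_le_smul_of_le_jacobson_bot (I := maximalIdeal R)
      (IsNoetherian.noetherian _) (IsLocalRing.maximalIdeal_le_jacobson _) fun y hy ↦ ?_
    have hy' := Ideal.mem_map_of_mem (Ideal.Quotient.mk I) hy
    rw [hmap, ← hspan, Ideal.mem_quotient_iff_mem_sup] at hy'
    rw [smul_eq_mul, ← sq]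
    exact sup_le_sup_left hI _ hy'
  rw [hle.antisymm' heq]
  refine (Submodule.spanFinrank_span_le_ncard_of_finite (hG.image g)).trans ?_
  rw [← Submodule.FG.generators_ncard hfg]
  exact Set.ncard_image_le hG

end IsLocalRing

namespace IsRegularLocalRing

open IsLocalRing

variable {R : Type*} [CommRing R]

/-- The quotient of a regular local ring by an element of `m ∖ m²` is a regular local ring,
of dimension one less. -/
theorem quotient_span_singleton [IsRegularLocalRing R] {f : R} (hf : f ∈ maximalIdeal R)
    (hf2 : f ∉ maximalIdeal R ^ 2) :
    ∃ _ : IsRegularLocalRing (R ⧸ Ideal.span {f}),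
      (maximalIdeal (R ⧸ Ideal.span {f})).spanFinrank + 1 = (maximalIdeal R).spanFinrank := by
  classical
  obtain ⟨t, ht, htc⟩ := exists_maximalIdeal_eq_span_insert hf hf2
  have hne : Ideal.span {f} ≠ ⊤ := fun h ↦ by
    rw [Ideal.span_singleton_eq_top] at h
    exact (IsLocalRing.mem_maximalIdeal _).1 hf h
  have : Nontrivial (R ⧸ Ideal.span {f}) := Ideal.Quotient.nontrivial_iff.2 hne
  have : IsLocalRing (R ⧸ Ideal.span {f}) :=
    .of_surjective' (Ideal.Quotient.mk _) Ideal.Quotient.mk_surjective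
  have hmap : maximalIdeal (R ⧸ Ideal.span {f}) =
      Ideal.span (t.image (Ideal.Quotient.mk (Ideal.span {f})) : Set _) := by
    rw [← IsLocalRing.map_maximalIdeal_of_surjective (Ideal.Quotient.mk (Ideal.span {f}))
      Ideal.Quotient.mk_surjective, ht, Ideal.map_span, Set.image_insert_eq,
      Ideal.Quotient.eq_zero_iff_mem.2 (Ideal.mem_span_singleton_self f), Ideal.span_insert_zero]
    simp
  have h1 : (maximalIdeal (R ⧸ Ideal.span {f})).spanFinrank ≤ t.card := by
    rw [hmap]
    refine (Submodule.spanFinrank_span_le_ncard_of_finite (Finset.finite_toSet _)).trans ?_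
    rw [Set.ncard_coe_finset]
    exact Finset.card_image_le
  -- One equation lowers the dimension by at most one. So the quotient has dimension at least
  -- `t.card`, which already bounds its number of generators from above, and all these numbers
  -- coincide.
  have h2 : ringKrullDim R ≤ ringKrullDim (R ⧸ Ideal.span {f}) + 1 := by
    have := ringKrullDim_le_ringKrullDim_quotient_add_card {f}
      (by simpa [IsLocalRing.ringJacobson_eq_maximalIdeal] using hf)
    rw [Finset.coe_singleton, Finset.card_singleton] at this
    exact_mod_cast this
  rw [← IsRegularLocalRing.spanFinrank_maximalIdeal, ← htc] at h2
  have h3 : (t.card : WithBot ℕ∞) ≤ ringKrullDim (R ⧸ Ideal.span {f}) := by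
    push_cast at h2
    exact ENat.WithBot.add_le_add_one_right_iff.1 h2
  have h4 : IsRegularLocalRing (R ⧸ Ideal.span {f}) :=
    of_spanFinrank_maximalIdeal_le _ ((Nat.cast_le.2 h1).trans h3)
  refine ⟨h4, ?_⟩
  rw [← htc, add_left_inj]
  refine h1.antisymm ?_
  rw [← h4.spanFinrank_maximalIdeal] at h3
  exact_mod_cast h3

/-- Regular local rings are integral domains. -/
theorem isDomain (R : Type*) [CommRing R] [IsRegularLocalRing R] : IsDomain R := by
  induction hd : (maximalIdeal R).spanFinrank generalizing R with
  | zero =>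
    have : maximalIdeal R = ⊥ :=
      (Submodule.spanFinrank_eq_zero_iff_eq_bot (IsNoetherian.noetherian _)).1 hd
    exact (isField_iff_maximalIdeal_eq.2 this).isDomain
  | succ d ih =>
    have hm : ¬ maximalIdeal R ≤ maximalIdeal R ^ 2 := fun h ↦ by
      have := Submodule.eq_bot_of_le_smul_of_le_jacobson_bot (maximalIdeal R) (maximalIdeal R)
        (IsNoetherian.noetherian _) (by simpa [sq] using h)
        (IsLocalRing.maximalIdeal_le_jacobson _)
      rw [this, Submodule.spanFinrank_bot] at hd
      exact absurd hd (by omega)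
    -- Otherwise `m` is a minimal prime, of height `0`, while the dimension is `d + 1`.
    have hmin : ∀ P ∈ minimalPrimes R, ¬ maximalIdeal R ≤ P := fun P hP h ↦ by
      have hP' : P = maximalIdeal R := le_antisymm (le_maximalIdeal hP.1.1.ne_top) h
      have : (maximalIdeal R).height = 0 := by
        rw [← hP']
        have := hP.1.1
        exact Ideal.height_eq_zero_iff.2 hP
      have h2 := maximalIdeal_height_eq_ringKrullDim (R := R)
      rw [this, ← IsRegularLocalRing.spanFinrank_maximalIdeal, hd] at h2
      norm_cast at h2
    obtain ⟨x, hx, hx'⟩ : ∃ x ∈ maximalIdeal R, x ∉ maximalIdeal R ^ 2 ∧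
        ∀ P ∈ minimalPrimes R, x ∉ P := by
      by_contra! H
      -- Prime avoidance tolerates up to two non-prime members; `m²` is the only one here and fills
      -- both exceptional slots.
      have := (Ideal.subset_union_prime_finite (I := maximalIdeal R)
        ((minimalPrimes.finite_of_isNoetherianRing R).insert (maximalIdeal R ^ 2)) (f := id)
        (maximalIdeal R ^ 2) (maximalIdeal R ^ 2) (fun P hP h _ ↦ by
          rcases hP with rfl | hP
          · exact absurd rfl h
          · exact hP.1.1)).1 (fun y hy ↦ by
            by_cases hy2 : y ∈ maximalIdeal R ^ 2
            · exact Set.mem_biUnion (Set.mem_insert _ _) hy2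
            · obtain ⟨P, hP, hyP⟩ := H y hy hy2
              exact Set.mem_biUnion (Set.mem_insert_of_mem _ hP) hyP)
      obtain ⟨P, rfl | hP, hP2⟩ := this
      · exact hm hP2
      · exact hmin P hP hP2
    obtain ⟨h1, h2⟩ := quotient_span_singleton hx hx'.1
    have hdom := ih (R ⧸ Ideal.span {x}) (by omega)
    have hprime : (Ideal.span {x}).IsPrime := (Ideal.Quotient.isDomain_iff_prime _).1 hdom
    obtain ⟨P, hP, hPx⟩ := Ideal.exists_minimalPrimes_le (I := (⊥ : Ideal R)) (bot_le (a := Ideal.span {x}))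
    have hPp : P.IsPrime := hP.1.1
    -- `P ⊆ (x)` and `x ∉ P`: an element `a * x` of `P` has `a ∈ P`, so `P ⊆ m P` and Nakayama
    -- applies.
    have hP0 : P = ⊥ := by
      refine Submodule.eq_bot_of_le_smul_of_le_jacobson_bot (maximalIdeal R) P
        (IsNoetherian.noetherian _) (fun y hy ↦ ?_) (IsLocalRing.maximalIdeal_le_jacobson _)
      obtain ⟨a, rfl⟩ := Ideal.mem_span_singleton'.1 (hPx hy)
      have ha := (hPp.mem_or_mem hy).resolve_right (hx'.2 P hP)
      rw [mul_comm]
      exact Submodule.smul_mem_smul hx ha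
    rw [hP0] at hPp
    exact IsDomain.of_bot_isPrime R

/-- If `R` and `R ⧸ I` are regular local rings, then `I ∩ m² ⊆ m I`, that is, `I` is generated by
part of a regular system of parameters. -/
theorem inf_maximalIdeal_sq_le (R : Type*) [CommRing R] [IsRegularLocalRing R] (I : Ideal R)
    [hI : IsRegularLocalRing (R ⧸ I)] : I ⊓ maximalIdeal R ^ 2 ≤ maximalIdeal R * I := by
  induction hd : (maximalIdeal R).spanFinrank generalizing R with
  | zero =>
    have : maximalIdeal R = ⊥ :=
      (Submodule.spanFinrank_eq_zero_iff_eq_bot (IsNoetherian.noetherian _)).1 hd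
    rw [this]
    simp
  | succ d ih =>
    have hIm : I ≤ maximalIdeal R :=
      le_maximalIdeal (Ideal.Quotient.nontrivial_iff.1 inferInstance)
    by_cases hI2 : I ≤ maximalIdeal R ^ 2
    -- When `I ⊆ m²`, passing to `R ⧸ I` does not lower the number of generators of the maximal
    -- ideal, hence, both rings being regular, not the dimension. A nonzero `y ∈ I` is a
    -- nonzerodivisor of the domain `R` and would lower it.
    · suffices I = ⊥ by simp [this]
      by_contra hne
      obtain ⟨y, hyI, hy0⟩ := Submodule.exists_mem_ne_zero_of_ne_bot hne
      have := isDomain R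
      have h1 := ringKrullDim_quotient_succ_le_of_nonZeroDivisor (mem_nonZeroDivisors_of_ne_zero hy0)
      have h2 : ringKrullDim (R ⧸ I) ≤ ringKrullDim (R ⧸ Ideal.span {y}) :=
        ringKrullDim_le_of_surjective (Ideal.Quotient.factor
          ((Ideal.span_singleton_le_iff_mem I).2 hyI)) (Ideal.Quotient.factor_surjective _)
      have h3 := spanFinrank_maximalIdeal_le_quotient hI2
      have h4 := (add_le_add_left h2 1).trans h1
      rw [← hI.spanFinrank_maximalIdeal, ← IsRegularLocalRing.spanFinrank_maximalIdeal] at h4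
      norm_cast at h4
      omega
    · obtain ⟨f, hfI, hf2⟩ := Set.not_subset.1 hI2
      obtain ⟨h1, h2⟩ := quotient_span_singleton (hIm hfI) hf2
      have hfle : Ideal.span {f} ≤ I := (Ideal.span_singleton_le_iff_mem I).2 hfI
      have : IsRegularLocalRing
          ((R ⧸ Ideal.span {f}) ⧸ I.map (Ideal.Quotient.mk (Ideal.span {f}))) :=
        of_ringEquiv (DoubleQuot.quotQuotEquivQuotOfLE hfle).symm
      have h3 := ih (R ⧸ Ideal.span {f}) (I.map (Ideal.Quotient.mk _)) (by omega)
      rw [← IsLocalRing.map_maximalIdeal_of_surjective (Ideal.Quotient.mk (Ideal.span {f}))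
        Ideal.Quotient.mk_surjective, ← Ideal.map_pow, ← Ideal.map_mul] at h3
      intro y hy
      have h4 := h3 ⟨Ideal.mem_map_of_mem _ hy.1, Ideal.mem_map_of_mem _ hy.2⟩
      rw [Ideal.mem_quotient_iff_mem_sup] at h4
      obtain ⟨z, hz, w, hw, hzw⟩ := Submodule.mem_sup.1 h4
      obtain ⟨a, rfl⟩ := Ideal.mem_span_singleton'.1 hw
      have haf : a * f ∈ maximalIdeal R ^ 2 := by
        rw [← eq_sub_iff_add_eq'] at hzw
        rw [hzw, sq]
        exact sub_mem (sq (maximalIdeal R) ▸ hy.2) (Ideal.mul_mono_right hIm hz)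
      -- Both `y` and `z` lie in `m²`, hence so does `a * f`; a unit `a` would put `f` itself in
      -- `m²`.
      have ha : a ∈ maximalIdeal R := by
        by_contra hau
        obtain ⟨u, rfl⟩ := IsLocalRing.notMem_maximalIdeal.1 hau
        exact hf2 ((Ideal.unit_mul_mem_iff_mem _ u.isUnit).1 haf)
      rw [← hzw]
      exact add_mem hz (Ideal.mul_mem_mul ha hfI)

end IsRegularLocalRing

/-! ### Smoothness of regular algebras over perfect fields -/

section Smooth

open IsLocalRing TensorProduct

/-- If `P → K` is surjective with kernel `J`, then `1 ⊗ y = 0` in `K ⊗[P] N` if and only if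
`y ∈ J N`. -/
theorem one_tmul_eq_zero_iff_of_surjective {P K N : Type*} [CommRing P] [CommRing K] [Algebra P K]
    [AddCommGroup N] [Module P N] (hK : Function.Surjective (algebraMap P K)) (y : N) :
    (1 : K) ⊗ₜ[P] y = 0 ↔ y ∈ RingHom.ker (algebraMap P K) • (⊤ : Submodule P N) := by
  let e : (P ⧸ RingHom.ker (algebraMap P K)) ≃ₐ[P] K :=
    Ideal.quotientKerAlgEquivOfSurjective (f := Algebra.ofId P K) hK
  have h := LinearMap.ker_tensorProductMk (Q := N) (I := RingHom.ker (algebraMap P K))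
  rw [← h, LinearMap.mem_ker, TensorProduct.mk_apply,
    ← (TensorProduct.congr e.toLinearEquiv (LinearEquiv.refl P N)).map_eq_zero_iff,
    TensorProduct.congr_tmul]
  simp

/-- Jacobian criterion: with `J` the kernel of `P → R` and `K` the residue field, `R` is formally
smooth iff `K ⊗ J → K ⊗ Ω[P⁄k]` is injective. Formal smoothness of `K` gives this injectivity for
the maximal ideal of `P` in place of `J`, and regularity of both rings makes `J/mJ → m/m²`
injective. -/
theorem IsRegularLocalRing.formallySmooth_of_surjective (k P R : Type*) [Field k] [CommRing P]
    [CommRing R] [Algebra k P] [Algebra k R] [Algebra P R] [IsScalarTower k P R]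
    [IsRegularLocalRing P] [IsRegularLocalRing R] [Algebra.FormallySmooth k P]
    [Module.Finite P Ω[P⁄k]] (hPR : Function.Surjective (algebraMap P R))
    [Algebra.FormallySmooth k (ResidueField R)] : Algebra.FormallySmooth k R := by
  let K := ResidueField R
  have : IsScalarTower k P K := .to₁₂₄ k P R K
  have hRK : Function.Surjective (algebraMap R K) := IsLocalRing.residue_surjective
  have hPK : Function.Surjective (algebraMap P K) := hRK.comp hPR
  have : Module.Free P Ω[P⁄k] := Module.free_of_flat_of_isLocalRing
  have hker : RingHom.ker (algebraMap P K) = maximalIdeal P :=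
    IsLocalRing.eq_maximalIdeal (RingHom.ker_isMaximal_of_surjective _ hPK)
  have hle : RingHom.ker (algebraMap P R) ≤ RingHom.ker (algebraMap P K) := fun y hy ↦ by
    rw [RingHom.mem_ker] at hy ⊢
    rw [IsScalarTower.algebraMap_apply P R K, hy, map_zero]
  have hK := (Algebra.FormallySmooth.iff_injective_cotangentComplexBaseChange (R := k) (S := K) P K
    hPK (IsNoetherian.noetherian _) (by
      rw [IsLocalRing.isField_iff_maximalIdeal_eq.1 (Field.toIsField K)]; exact bot_le)).1
      inferInstance
  rw [Algebra.FormallySmooth.iff_injective_cotangentComplexBaseChange_residueField P hPR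
    (IsNoetherian.noetherian _), injective_iff_map_eq_zero]
  intro z hz
  obtain ⟨y, rfl⟩ := TensorProduct.mk_surjective P _ K hPK z
  rw [TensorProduct.mk_apply] at hz ⊢
  -- The differential of `y` is the same whether `y` is viewed in `J` or in the maximal ideal, so
  -- the criterion for `P → K` applies to it.
  have h1 : (1 : K) ⊗ₜ[P] (⟨y.1, hle y.2⟩ : RingHom.ker (algebraMap P K)) = 0 := by
    apply hK
    rw [map_zero, ← hz]
    rfl
  rw [one_tmul_eq_zero_iff_of_surjective hPK] at h1
  rw [one_tmul_eq_zero_iff_of_surjective hPK, hker]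
  have h2 : y.1 ∈ maximalIdeal P ^ 2 := by
    rw [sq, ← hker]
    exact (Submodule.mem_smul_top_iff _ _ _).1 h1
  have hreg : IsRegularLocalRing (P ⧸ RingHom.ker (algebraMap P R)) :=
    .of_ringEquiv (RingHom.quotientKerEquivOfSurjective hPR).symm
  have h3 := IsRegularLocalRing.inf_maximalIdeal_sq_le P (RingHom.ker (algebraMap P R)) ⟨y.2, h2⟩
  exact (Submodule.mem_smul_top_iff _ _ _).2 h3

/-- A prime of an algebra of finite type over a perfect field at which the local ring is regular is
a smooth point. -/
theorem isSmoothAt_of_isRegularLocalRing (k A : Type*) [Field k] [PerfectField k] [CommRing A]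
    [Algebra k A] [Algebra.FiniteType k A] (p : Ideal A) [p.IsPrime]
    [IsRegularLocalRing (Localization.AtPrime p)] : Algebra.IsSmoothAt k p := by
  -- The local ring of `A` at `p` is a quotient of the local ring of affine space at the preimage
  -- `q` of `p`.
  obtain ⟨n, f, hf⟩ := Algebra.FiniteType.iff_quotient_mvPolynomial''.1 ‹Algebra.FiniteType k A›
  let q := p.comap f.toRingHom
  let P := Localization.AtPrime q
  let R := Localization.AtPrime p
  let φ : P →+* R := Localization.localRingHom q p f.toRingHom rfl
  have hφ : Function.Surjective φ := by
    intro z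
    obtain ⟨a, s, rfl⟩ := IsLocalization.exists_mk'_eq p.primeCompl z
    obtain ⟨a, rfl⟩ := hf a
    obtain ⟨s, hs⟩ := s
    obtain ⟨s, rfl⟩ := hf s
    exact ⟨IsLocalization.mk' _ a (⟨s, hs⟩ : q.primeCompl), Localization.localRingHom_mk' _ _ _ _ _ _⟩
  let _ : Algebra P R := φ.toAlgebra
  have : IsScalarTower k P R := .of_algebraMap_eq fun x ↦ by
    rw [IsScalarTower.algebraMap_apply k (MvPolynomial (Fin n) k) P, RingHom.algebraMap_toAlgebra,
      Localization.localRingHom_to_map, IsScalarTower.algebraMap_apply k A R]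
    exact congrArg _ (f.commutes x).symm
  have : Algebra.EssFiniteType k P := .comp k (MvPolynomial (Fin n) k) P
  have : Algebra.EssFiniteType k R := .comp k A R
  have : Algebra.EssFiniteType k (ResidueField R) := .comp k R _
  have : Algebra.FormallySmooth k P := .comp k (MvPolynomial (Fin n) k) P
  exact IsRegularLocalRing.formallySmooth_of_surjective k P R hφ

/-- A regular point of an algebra of finite type over a perfect field has a principal open
neighbourhood on which the module of differentials has a finite basis of exact differentials. -/
theorem exists_basis_kaehlerDifferential_of_isRegularLocalRing (k A : Type*) [Field k]
    [PerfectField k] [CommRing A] [Algebra k A] [Algebra.FiniteType k A] (p : Ideal A) [p.IsPrime]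
    [IsRegularLocalRing (Localization.AtPrime p)] :
    ∃ g ∉ p, ∃ (d : ℕ) (b : Module.Basis (Fin d) (Localization.Away g) Ω[Localization.Away g⁄k])
      (f : Fin d → Localization.Away g), ∀ i, b i = KaehlerDifferential.D k _ (f i) := by
  have := isSmoothAt_of_isRegularLocalRing k A p
  have : Algebra.FinitePresentation k A := Algebra.FinitePresentation.of_finiteType.1 inferInstance
  obtain ⟨g, hg, h⟩ := Algebra.IsSmoothAt.exists_notMem_isStandardSmooth k p
  obtain ⟨-, I, b, hb⟩ := Algebra.IsStandardSmooth.iff_exists_basis_kaehlerDifferential.1 h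
  -- Finiteness of a basis of a finite module needs a nontrivial ring; `A_g` maps to the nonzero
  -- ring `A_p` because `g ∉ p`.
  have : Nontrivial (Localization.Away g) := by
    have hu : IsUnit (algebraMap A (Localization.AtPrime p) g) :=
      IsLocalization.map_units (Localization.AtPrime p) (⟨g, hg⟩ : p.primeCompl)
    exact (IsLocalization.Away.lift (S := Localization.Away g) g hu).domain_nontrivial
  have : Algebra.FiniteType k (Localization.Away g) := inferInstance
  have := Module.Finite.finite_basis b
  choose f hf using fun i ↦ hb ⟨i, rfl⟩
  exact ⟨g, hg, Nat.card I, b.reindex (Finite.equivFin I), f ∘ (Finite.equivFin I).symm,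
    fun i ↦ by simp [hf]⟩

end Smooth

noncomputable section

/-! ### Bases of modules of principal parts -/

section PrincipalPartsBasis

open MvPolynomial KaehlerDifferential

variable {k R : Type*} [Field k] [CommRing R] [Algebra k R]

/-- The `R`-linear extension `a ⊗ b ↦ a ⊗ ∂ b` to `R ⊗[k] R` of a `k`-derivation `∂` of `R`. -/
def Derivation.lTensorSelf (δ : Derivation k R R) : Derivation R (R ⊗[k] R) (R ⊗[k] R) :=
  Derivation.mk' (TensorProduct.AlgebraTensorModule.map (LinearMap.id : R →ₗ[R] R) δ.toLinearMap) <| by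
    intro x y
    induction x with
    | zero => simp
    | add x x' hx hx' => simp only [add_mul, map_add, hx, hx', smul_eq_mul, mul_add]; ring
    | tmul a b =>
      induction y with
      | zero => simp
      | add y y' hy hy' => simp only [mul_add, map_add, hy, hy', smul_eq_mul, add_mul]; ring
      | tmul c d =>
        simp [TensorProduct.tmul_add, mul_comm a c]

@[simp]
theorem Derivation.lTensorSelf_tmul (δ : Derivation k R R) (a b : R) :
    δ.lTensorSelf (a ⊗ₜ b) = a ⊗ₜ δ b := rfl

/-- By the Leibniz rule a derivation removes at most one factor from a product of elements of `I`.
-/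
theorem Derivation.apply_mem_pow {A B : Type*} [CommRing A] [CommRing B] [Algebra A B]
    (δ : Derivation A B B) (I : Ideal B) (n : ℕ) {x : B} (hx : x ∈ I ^ (n + 1)) : δ x ∈ I ^ n := by
  induction n generalizing x with
  | zero => simp
  | succ n ih =>
    rw [pow_succ'] at hx
    induction hx using Submodule.mul_induction_on' with
    | mem_mul_mem a ha b hb =>
      rw [Derivation.leibniz, smul_eq_mul, smul_eq_mul]
      refine add_mem ?_ (Ideal.mul_mem_right _ _ hb)
      rw [pow_succ']
      exact Ideal.mul_mem_mul ha (ih hb)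
    | add a _ b _ ha hb => rw [map_add]; exact add_mem ha hb

variable (k) in
/-- The element `1 ⊗ f - f ⊗ 1` of `R ⊗[k] R`. -/
def diagDiff (f : R) : R ⊗[k] R := 1 ⊗ₜ f - f ⊗ₜ 1

theorem diagDiff_mem (f : R) : diagDiff k f ∈ ideal k R :=
  one_smul_sub_smul_one_mem_ideal k f

theorem Derivation.lTensorSelf_diagDiff (δ : Derivation k R R) (f : R) :
    δ.lTensorSelf (diagDiff k f) = 1 ⊗ₜ δ f := by
  simp [diagDiff]

variable {ι : Type*} (f : ι → R)

/-- When `δ` is dual to `f i`, its extension sends `diagDiff k (f j)` to `1` or `0`; the `diagDiff k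
(f j)` thus behave as coordinates, and the formula is the chain rule. -/
theorem Derivation.lTensorSelf_aeval_diagDiff [DecidableEq ι] {δ : Derivation k R R} {i : ι}
    (hδ : ∀ j, δ (f j) = if j = i then 1 else 0) (p : MvPolynomial ι R) :
    δ.lTensorSelf (aeval (fun j ↦ diagDiff k (f j)) p) =
      aeval (fun j ↦ diagDiff k (f j)) (pderiv i p) := by
  induction p using MvPolynomial.induction_on with
  | C a => simp
  | add p q hp hq => simp only [map_add, hp, hq]
  | mul_X p j hp =>
    rw [map_mul, Derivation.leibniz, hp, aeval_X, lTensorSelf_diagDiff, hδ, pderiv_mul, map_add,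
      map_mul, aeval_X, pderiv_X, smul_eq_mul, smul_eq_mul, map_mul, Pi.single_apply]
    split_ifs with h
    · subst h
      simp [Algebra.TensorProduct.one_def, mul_comm, add_comm]
    · simp [mul_comm]

/-- If `m i ≠ 0`, then `m i` times the coefficient at `m` is a coefficient of `pderiv i p`. The
integer `m i` is invertible in `R`, which is an algebra over a field of characteristic zero. -/
theorem MvPolynomial.eq_C_of_pderiv_eq_zero [CharZero k] {p : MvPolynomial ι R}
    (h : ∀ i, pderiv i p = 0) : p = C (coeff 0 p) := by
  classical
  ext m
  rw [coeff_C]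
  split_ifs with hm
  · rw [hm]
  · obtain ⟨i, hi⟩ : ∃ i, m i ≠ 0 := by
      by_contra! H
      exact hm (Finsupp.ext fun i ↦ (H i).symm)
    have h1 := congrArg (coeff (m - Finsupp.single i 1)) (h i)
    rw [coeff_pderiv, coeff_zero, tsub_add_cancel_of_le (by
      rw [Finsupp.single_le_iff]; omega)] at h1
    have h2 : IsUnit ((((m - Finsupp.single i 1 : ι →₀ ℕ) i + 1 : ℕ)) : R) := by
      rw [← map_natCast (algebraMap k R)]
      exact (IsUnit.mk0 _ (Nat.cast_ne_zero.2 (Nat.succ_ne_zero _))).map _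
    rw [Nat.cast_add, Nat.cast_one] at h2
    exact h2.mul_left_eq_zero.1 h1

/-- Independence of the monomials, by induction on `n`: the derivation dual to `df i` lowers both
the degree bound and the power of the ideal by one, so every partial derivative of `p` vanishes and
`p` is constant. -/
theorem eq_zero_of_aeval_diagDiff_mem [CharZero k] (b : Module.Basis ι R Ω[R⁄k])
    (hb : ∀ i, b i = D k R (f i)) (n : ℕ) (p : MvPolynomial ι R)
    (hp : ∀ m ∈ p.support, m.degree ≤ n)
    (h : aeval (fun j ↦ diagDiff k (f j)) p ∈ ideal k R ^ (n + 1)) : p = 0 := by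
  classical
  -- The multiplication map kills the ideal and sends `a ⊗ 1` to `a`, so a constant in the ideal is
  -- zero.
  have key : p = C (coeff 0 p) → p = 0 := fun h0 ↦ by
    rw [h0, aeval_C] at h
    have h1 : (algebraMap R (R ⊗[k] R)) (coeff 0 p) ∈ ideal k R := Ideal.pow_le_self (by omega) h
    rw [RingHom.mem_ker] at h1
    have : coeff 0 p = 0 := by simpa using h1
    rw [h0, this, C_0]
  induction n generalizing p with
  | zero =>
    apply key
    ext m
    rw [coeff_C]
    split_ifs with hm
    · rw [hm]
    · by_contra hne
      exact hm ((Finsupp.degree_eq_zero_iff m).1 (Nat.le_zero.1 (hp m (mem_support_iff.2 hne)))).symm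
  | succ n ih =>
    refine key (eq_C_of_pderiv_eq_zero (k := k) fun i ↦ ?_)
    let δ : Derivation k R R := (b.coord i).compDer (D k R)
    have hδ : ∀ j, δ (f j) = if j = i then 1 else 0 := fun j ↦ by
      change b.coord i (D k R (f j)) = _
      rw [← hb, Module.Basis.coord_apply, Module.Basis.repr_self, Finsupp.single_apply]
    have hmem : aeval (fun j ↦ diagDiff k (f j)) (pderiv i p) ∈ ideal k R ^ (n + 1) := by
      rw [← Derivation.lTensorSelf_aeval_diagDiff f hδ]
      exact Derivation.apply_mem_pow _ _ _ h
    -- The induction carries `key` along with `p`, so `key` is proved again for `pderiv i p`.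
    refine ih _ (fun m hm ↦ ?_) hmem fun h0 ↦ ?_
    · rw [mem_support_iff, coeff_pderiv] at hm
      have := hp (m + Finsupp.single i 1) (mem_support_iff.2 (left_ne_zero_of_mul hm))
      rw [map_add, Finsupp.degree_single] at this
      omega
    · rw [h0, aeval_C] at hmem
      rw [h0]
      have h1 : (algebraMap R (R ⊗[k] R)) (coeff 0 (pderiv i p)) ∈ ideal k R :=
        Ideal.pow_le_self (by omega) hmem
      rw [RingHom.mem_ker] at h1
      have : coeff 0 (pderiv i p) = 0 := by simpa using h1
      rw [this, C_0]

/-- Leading terms: for `n = 1` this is the expansion of a class in `I/I² = Ω` in the basis `df i`,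
and products of such expansions handle `I ^ n`. -/
theorem exists_isHomogeneous_sub_aeval_diagDiff_mem (b : Module.Basis ι R Ω[R⁄k])
    (hb : ∀ i, b i = D k R (f i)) (n : ℕ) {x : R ⊗[k] R} (hx : x ∈ ideal k R ^ n) :
    ∃ p : MvPolynomial ι R, p.IsHomogeneous n ∧
      x - aeval (fun j ↦ diagDiff k (f j)) p ∈ ideal k R ^ (n + 1) := by
  have h1 : ∀ y ∈ ideal k R, ∃ p : MvPolynomial ι R, p.IsHomogeneous 1 ∧
      y - aeval (fun j ↦ diagDiff k (f j)) p ∈ ideal k R ^ 2 := by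
    intro y hy
    let ω : Ω[R⁄k] := (ideal k R).toCotangent ⟨y, hy⟩
    refine ⟨(b.repr ω).sum fun i c ↦ C c * X i, ?_, ?_⟩
    · refine IsHomogeneous.sum _ _ _ fun i _ ↦ ?_
      simpa using (isHomogeneous_C ι (b.repr ω i)).mul (isHomogeneous_X R i)
    · have h2 : ω = (ideal k R).toCotangent ⟨aeval (fun j ↦ diagDiff k (f j))
          ((b.repr ω).sum fun i c ↦ C c * X i), by
            rw [Finsupp.sum, map_sum]
            refine sum_mem fun i _ ↦ ?_
            rw [map_mul, aeval_X]
            exact Ideal.mul_mem_left _ _ (diagDiff_mem _)⟩ := by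
        rw [← D_tensorProductTo]
        simp only [Finsupp.sum]
        rw [map_sum, map_sum]
        refine (b.linearCombination_repr ω).symm.trans ?_
        refine Finset.sum_congr rfl fun i _ ↦ ?_
        rw [map_mul, aeval_X, aeval_C, ← Algebra.smul_def, map_smul]
        simp [diagDiff, hb, Derivation.tensorProductTo_tmul]
      exact (Ideal.toCotangent_eq _).1 h2
  induction n generalizing x with
  | zero =>
    refine ⟨C (Algebra.TensorProduct.lmul' k (S := R) x), isHomogeneous_C _ _, ?_⟩
    rw [aeval_C, zero_add, pow_one, RingHom.mem_ker]
    simp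
  | succ n ih =>
    rw [pow_succ] at hx
    induction hx using Submodule.mul_induction_on' with
    | mem_mul_mem u hu v hv =>
      obtain ⟨p, hp, hup⟩ := ih hu
      obtain ⟨q, hq, hvq⟩ := h1 v hv
      refine ⟨p * q, hp.mul hq, ?_⟩
      -- The identity `uv - pq = (u - p) v + p (v - q)`, with `p` written as `u - (u - p)` to
      -- exhibit it as an element of `I ^ n`.
      rw [map_mul, show u * v - _ = (u - aeval (fun j ↦ diagDiff k (f j)) p) * v +
        ((u - (u - aeval (fun j ↦ diagDiff k (f j)) p)) *
          (v - aeval (fun j ↦ diagDiff k (f j)) q)) by ring]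
      refine add_mem ?_ ?_
      · rw [pow_succ]
        exact Ideal.mul_mem_mul hup hv
      · rw [add_assoc, pow_add]
        exact Ideal.mul_mem_mul (sub_mem hu (Ideal.pow_le_pow_right n.le_succ hup)) hvq
    | add u _ v _ hu hv =>
      obtain ⟨p, hp, hup⟩ := hu
      obtain ⟨q, hq, hvq⟩ := hv
      exact ⟨p + q, hp.add hq, by rw [map_add, add_sub_add_comm]; exact add_mem hup hvq⟩

/-- Successive approximation: the error in `I ^ (n + 1)` has a leading term of degree `n + 1`, which
is added to the polynomial. -/
theorem exists_sub_aeval_diagDiff_mem (b : Module.Basis ι R Ω[R⁄k])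
    (hb : ∀ i, b i = D k R (f i)) (n : ℕ) (x : R ⊗[k] R) :
    ∃ p : MvPolynomial ι R, (∀ m ∈ p.support, m.degree ≤ n) ∧
      x - aeval (fun j ↦ diagDiff k (f j)) p ∈ ideal k R ^ (n + 1) := by
  classical
  induction n with
  | zero =>
    obtain ⟨p, hp, h⟩ := exists_isHomogeneous_sub_aeval_diagDiff_mem f b hb 0 (x := x) (by simp)
    exact ⟨p, fun m hm ↦ (by rw [Finsupp.degree_eq_weight_one]; exact (hp (mem_support_iff.1 hm)).le), h⟩
  | succ n ih =>
    obtain ⟨p, hp, h⟩ := ih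
    obtain ⟨q, hq, h'⟩ := exists_isHomogeneous_sub_aeval_diagDiff_mem f b hb (n + 1) h
    refine ⟨p + q, fun m hm ↦ ?_, by rwa [map_add, ← sub_sub]⟩
    rcases Finset.mem_union.1 (support_add hm) with hm | hm
    · exact (hp m hm).trans n.le_succ
    · exact (by rw [Finsupp.degree_eq_weight_one]; exact (hq (mem_support_iff.1 hm)).le)


variable (k) in
/-- The class of the monomial `∏ (1 ⊗ f i - f i ⊗ 1) ^ m i`. -/
def PrincipalParts.monomial (n : ℕ) (m : ι →₀ ℕ) : PrincipalParts k R n :=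
  mk k R n (aeval (fun j ↦ diagDiff k (f j)) (MvPolynomial.monomial m (1 : R)))

theorem PrincipalParts.map_monomial {S : Type*} [CommRing S] [Algebra k S] (φ : R →ₐ[k] S) (n : ℕ)
    (m : ι →₀ ℕ) :
    map n φ (monomial k f n m) = monomial k (fun i ↦ φ (f i)) n m := by
  rw [monomial, map_mk, monomial]
  congr 1
  rw [aeval_monomial, aeval_monomial, map_one, one_mul, map_one, one_mul, Finsupp.prod, map_prod,
    Finsupp.prod]
  refine Finset.prod_congr rfl fun i _ ↦ ?_
  simp [diagDiff]

theorem PrincipalParts.mk_aeval_eq_sum (n : ℕ) {s : Finset (ι →₀ ℕ)} (p : MvPolynomial ι R)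
    (hp : p.support ⊆ s) : mk k R n (aeval (fun j ↦ diagDiff k (f j)) p) =
      ∑ m ∈ s, left k R n (p.coeff m) * monomial k f n m := by
  conv_lhs => rw [p.as_sum, map_sum, map_sum]
  rw [Finset.sum_subset hp (fun m _ hm ↦ by
    rw [notMem_support_iff.1 hm]; simp)]
  refine Finset.sum_congr rfl fun m _ ↦ ?_
  rw [monomial, left, RingHom.comp_apply, ← map_mul, aeval_monomial, aeval_monomial, map_one, one_mul]
  rfl

variable [Finite ι]

variable (ι) in
/-- The exponents of total degree at most `n`. -/
def exponents (n : ℕ) : Finset (ι →₀ ℕ) := (Finsupp.finite_of_degree_le (σ := ι) n).toFinset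

theorem mem_exponents {n : ℕ} {m : ι →₀ ℕ} : m ∈ exponents ι n ↔ m.degree ≤ n := by
  simp [exponents]

variable {M : Type*} [AddCommGroup M] [Module R M] {κ : Type*}

variable (k) in
/-- The elements `∏ (1 ⊗ f i - f i ⊗ 1) ^ m i ⊗ e l` of the module of principal parts. -/
def ModulePrincipalParts.monomial (n : ℕ) (e : κ → M) (j : exponents ι n × κ) :
    ModulePrincipalParts k R n M :=
  tmul n (PrincipalParts.monomial k f n j.1) (e j.2)

/-- If the `df i` form a basis of the module of differentials, then the module of
principal parts of a free module is free over `R`, with a basis of monomials. -/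
theorem ModulePrincipalParts.exists_basis [CharZero k] [Fintype κ] (b : Module.Basis ι R Ω[R⁄k])
    (hb : ∀ i, b i = D k R (f i)) (n : ℕ) (e : Module.Basis κ R M) :
    ∃ B : Module.Basis (exponents ι n × κ) R (ModulePrincipalParts k R n M),
      ∀ j, B j = monomial k f n e j := by
  have hli : LinearIndependent R (monomial k f n e) := by
    rw [Fintype.linearIndependent_iff]
    intro g hg
    let p : κ → MvPolynomial ι R := fun l ↦ ∑ m : exponents ι n, MvPolynomial.monomial m.1 (g (m, l))
    have hcoeff : ∀ l (m : exponents ι n), (p l).coeff m = g (m, l) := fun l m ↦ by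
      classical
      simp only [p, coeff_sum, coeff_monomial]
      rw [Finset.sum_eq_single m (fun m' _ h ↦ if_neg fun h' ↦ h (Subtype.ext h')) (by simp)]
      simp
    have hsupp : ∀ l, (p l).support ⊆ exponents ι n := fun l ↦ by
      classical
      refine support_sum.trans (Finset.biUnion_subset.2 fun m _ ↦ ?_)
      exact support_monomial_subset.trans (by simp)
    -- Grouped by `l`, the relation has coefficients in the principal parts algebra, over which the
    -- `1 ⊗ e l` are a basis; each coefficient therefore vanishes.
    have h1 : ∑ l, PrincipalParts.mk k R n (aeval (fun j ↦ diagDiff k (f j)) (p l)) •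
        (Algebra.TensorProduct.basis (PrincipalParts k R n) e l) = 0 := by
      refine Eq.trans ?_ hg
      rw [Fintype.sum_prod_type_right]
      refine Finset.sum_congr rfl fun l _ ↦ ?_
      rw [PrincipalParts.mk_aeval_eq_sum f n (p l) (hsupp l), ← Finset.sum_coe_sort, Finset.sum_smul]
      refine Finset.sum_congr rfl fun m _ ↦ ?_
      rw [hcoeff, Algebra.TensorProduct.basis_apply]
      exact congrArg (· ⊗ₜ[R] e l) (mul_one (_ * PrincipalParts.monomial k f n m))
    have h2 := Fintype.linearIndependent_iff.1
      (Algebra.TensorProduct.basis (PrincipalParts k R n) e).linearIndependent _ h1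
    intro ⟨m, l⟩
    have h3 := eq_zero_of_aeval_diagDiff_mem f b hb n (p l)
      (fun m hm ↦ mem_exponents.1 (hsupp l hm)) (Ideal.Quotient.eq_zero_iff_mem.1 (h2 l))
    rw [← hcoeff, h3, coeff_zero]
  have hspan : ⊤ ≤ Submodule.span R (Set.range (monomial k f n e)) := by
    rintro x -
    induction x using ModulePrincipalParts.induction_on with
    | zero => exact zero_mem _
    | add x y hx hy => exact add_mem hx hy
    | tmul q m =>
      -- The coordinates of `m` cross the tensor sign through the right structure map. It remains to
      -- span the principal parts algebra over the left one.
      have h1 : tmul n q m = ∑ l, tmul n (PrincipalParts.right k R n (e.repr m l) * q) (e l) := by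
        simp only [← tmul_smul]
        conv_lhs => rw [← e.sum_repr m]
        exact TensorProduct.tmul_sum _ _ _
      rw [h1]
      refine sum_mem fun l _ ↦ ?_
      generalize PrincipalParts.right k R n (e.repr m l) * q = q'
      obtain ⟨x, rfl⟩ := PrincipalParts.mk_surjective n q'
      obtain ⟨p, hp, hxp⟩ := exists_sub_aeval_diagDiff_mem f b hb n x
      have h2 : PrincipalParts.mk k R n x =
          PrincipalParts.mk k R n (aeval (fun j ↦ diagDiff k (f j)) p) :=
        Ideal.Quotient.eq.2 hxp
      rw [h2, PrincipalParts.mk_aeval_eq_sum f n (s := exponents ι n) p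
        fun m hm ↦ mem_exponents.2 (hp m hm)]
      have h3 : tmul n (∑ m ∈ exponents ι n, PrincipalParts.left k R n (p.coeff m) *
          PrincipalParts.monomial k f n m) (e l) = ∑ m ∈ exponents ι n, p.coeff m •
            tmul n (PrincipalParts.monomial k f n m) (e l) := by
        simp only [smul_def, smul_tmul]
        exact TensorProduct.sum_tmul _ _ _
      rw [h3]
      exact sum_mem fun m hm ↦ Submodule.smul_mem _ _ (Submodule.subset_span ⟨(⟨m, hm⟩, l), rfl⟩)
  exact ⟨.mk hli hspan, fun j ↦ Module.Basis.mk_apply _ _ _⟩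

end PrincipalPartsBasis

/-! ### Local homomorphisms out of the sheaf of principal parts -/

namespace AlgebraicGeometry.Scheme

section LocalFrame

variable {k : Type u} [Field k] {X : Scheme.{u}} [X.Over (Spec (CommRingCat.of k))]
  {M : X.Modules} {n : ℕ}

variable (k M n) in
/-- The canonical map from the presheaf to the sheaf of principal parts, on sections. -/
def principalPartsSection (U : X.Opens) :
    ModulePrincipalParts k Γ(X, U) n Γ(M, U) →+ Γ(principalParts k M n, U) :=
  ((toPrincipalParts k M n).app (op U)).hom

theorem principalPartsSection_smul {U : X.Opens} (r : Γ(X, U))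
    (p : ModulePrincipalParts k Γ(X, U) n Γ(M, U)) :
    principalPartsSection k M n U (r • p) = r • principalPartsSection k M n U p :=
  toPrincipalParts_smul k M n U r p

theorem map_principalPartsSection {U W : X.Opens} (i : W ⟶ U)
    (p : ModulePrincipalParts k Γ(X, U) n Γ(M, U)) :
    (principalParts k M n).presheaf.map i.op (principalPartsSection k M n U p) =
      principalPartsSection k M n W (principalPartsRes k M n i p) :=
  congr($((toPrincipalParts k M n).naturality i.op) p).symm

/-- Sheafification is locally surjective and, in the next lemma, locally injective; these two facts
reduce questions on the sheaf to the presheaf. -/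
theorem exists_principalPartsSection_eq {U : X.Opens} (s : Γ(principalParts k M n, U)) {x : X}
    (hx : x ∈ U) : ∃ (W : X.Opens) (h : W ≤ U) (p : ModulePrincipalParts k Γ(X, W) n Γ(M, W)),
      x ∈ W ∧ principalPartsSection k M n W p =
        (principalParts k M n).presheaf.map (homOfLE h).op s := by
  have h : Presheaf.IsLocallySurjective (Opens.grothendieckTopology X) (toPrincipalParts k M n) :=
    inferInstanceAs (Presheaf.IsLocallySurjective _ (toSheafify _ _))
  obtain ⟨W, i, ⟨p, hp⟩, hxW⟩ := h.imageSieve_mem s x hx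
  exact ⟨W, i.le, p, hxW, hp⟩

theorem exists_principalPartsRes_eq {U : X.Opens}
    {p q : ModulePrincipalParts k Γ(X, U) n Γ(M, U)}
    (hpq : principalPartsSection k M n U p = principalPartsSection k M n U q) {x : X}
    (hx : x ∈ U) : ∃ (W : X.Opens) (h : W ≤ U), x ∈ W ∧
      principalPartsRes k M n (homOfLE h) p = principalPartsRes k M n (homOfLE h) q := by
  have h : Presheaf.IsLocallyInjective (Opens.grothendieckTopology X) (toPrincipalParts k M n) :=
    inferInstanceAs (Presheaf.IsLocallyInjective _ (toSheafify _ _))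
  obtain ⟨W, i, hi, hxW⟩ := h.equalizerSieve_mem (X := op U) p q hpq x hx
  exact ⟨W, i.le, hxW, hi⟩

/-- A family `β` of sections over `U` of the presheaf of principal parts is a basis on an open
subset `Z ⊆ U`. -/
def IsBasisOn {U : X.Opens} {J : Type*} (β : J → ModulePrincipalParts k Γ(X, U) n Γ(M, U))
    (Z : X.Opens) : Prop :=
  ∃ (h : Z ≤ U) (B : Module.Basis J Γ(X, Z) (ModulePrincipalParts k Γ(X, Z) n Γ(M, Z))),
    ∀ j, B j = principalPartsRes k M n (homOfLE h) (β j)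

/-- A family `β` of sections over `U` of the presheaf of principal parts is a local frame if
it is a basis on arbitrarily small neighbourhoods of every point of `U`. -/
def IsLocalFrame {U : X.Opens} {J : Type*}
    (β : J → ModulePrincipalParts k Γ(X, U) n Γ(M, U)) : Prop :=
  ∀ W ≤ U, ∀ x ∈ W, ∃ Z ≤ W, x ∈ Z ∧ IsBasisOn β Z

variable {U : X.Opens} {J : Type*}
  {β : J → ModulePrincipalParts k Γ(X, U) n Γ(M, U)} {G : X.Modules}

/-- Sections of a sheaf are equal if they agree on neighbourhoods, on which a local frame is a
basis. -/
theorem IsLocalFrame.section_ext (hβ : IsLocalFrame β) {W : X.Opens} (hW : W ≤ U) {s t : Γ(G, W)}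
    (h : ∀ x ∈ W, ∃ W' : X.Opens, ∃ h' : W' ≤ W, x ∈ W' ∧ ∀ Z (hZ : Z ≤ W'), IsBasisOn β Z →
      G.presheaf.map (homOfLE (hZ.trans h')).op s = G.presheaf.map (homOfLE (hZ.trans h')).op t) :
    s = t := by
  choose W' hW' hx' H using h
  choose Z hZ hxZ hbZ using fun x : W ↦ hβ (W' x x.2) ((hW' x x.2).trans hW) x (hx' x x.2)
  exact G.eq_of_locally_eq Z W (fun x ↦ (hZ x).trans (hW' x x.2))
    (fun x hx ↦ Opens.mem_iSup.2 ⟨⟨x, hx⟩, hxZ _⟩) s t fun x ↦ H x x.2 (Z x) (hZ x) (hbZ x)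

/-- Two sections of the presheaf of principal parts over a basis neighbourhood have coordinates. -/
theorem IsBasisOn.exists_eq_sum [Fintype J] {Z : X.Opens} (hZ : IsBasisOn β Z)
    (p : ModulePrincipalParts k Γ(X, Z) n Γ(M, Z)) :
    ∃ a : J → Γ(X, Z), p = ∑ j, a j • principalPartsRes k M n (homOfLE hZ.1) (β j) := by
  obtain ⟨h, B, hB⟩ := hZ
  exact ⟨B.repr p, by simp only [← hB]; exact (B.sum_repr p).symm⟩

/-- Homomorphisms out of the sheaf of principal parts can be prescribed on a local frame. -/
theorem IsLocalFrame.exists_localHom_app_eq [Finite J] (hβ : IsLocalFrame β) {W : X.Opens}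
    (hW : W ≤ U) (c : J → Γ(G, W)) : ∃ P : (principalParts k M n).LocalHom G W,
      ∀ j, P.app W le_rfl (principalPartsSection k M n W
        (principalPartsRes k M n (homOfLE hW) (β j))) = c j := by
  have := Fintype.ofFinite J
  -- the value of the homomorphism on a section of the presheaf over a basis neighbourhood
  let φ : ∀ Z : X.Opens, Z ≤ W → IsBasisOn β Z →
      ModulePrincipalParts k Γ(X, Z) n Γ(M, Z) →ₗ[Γ(X, Z)] Γ(G, Z) := fun Z h hb ↦
    hb.2.choose.constr Γ(X, Z) fun j ↦ G.presheaf.map (homOfLE h).op (c j)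
  -- The values on the frame do not depend on the basis picked by `choose`; hence `φ` is compatible
  -- with restriction.
  have hφ : ∀ Z h hb j, φ Z h hb (principalPartsRes k M n (homOfLE (h.trans hW)) (β j)) =
      G.presheaf.map (homOfLE h).op (c j) := fun Z h hb j ↦ by
    rw [← hb.2.choose_spec j]
    exact Module.Basis.constr_basis _ _ _ _
  have hφres : ∀ Z h hb Z' (h' : Z' ≤ Z) hb' p, φ Z' (h'.trans h) hb'
      (principalPartsRes k M n (homOfLE h') p) = G.presheaf.map (homOfLE h').op (φ Z h hb p) := by
    intro Z h hb Z' h' hb' p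
    obtain ⟨a, rfl⟩ := hb.exists_eq_sum p
    simp only [map_sum, map_smul, principalPartsRes_smul, Modules.map_smul, hφ,
      ← principalPartsRes_comp, homOfLE_comp, Modules.map_map]
  -- Elements with the same image in the sheaf agree locally, and `G` is separated, so `φ` factors
  -- through that image.
  have hφext : ∀ Z h hb p q, principalPartsSection k M n Z p = principalPartsSection k M n Z q →
      φ Z h hb p = φ Z h hb q := by
    intro Z h hb p q hpq
    refine hβ.section_ext (h.trans hW) fun x hx ↦ ?_
    obtain ⟨W', hW', hxW', h2⟩ := exists_principalPartsRes_eq hpq hx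
    refine ⟨W', hW', hxW', fun Z' hZ' hb' ↦ ?_⟩
    rw [← hφres Z h hb Z' (hZ'.trans hW') hb', ← hφres Z h hb Z' (hZ'.trans hW') hb',
      ← homOfLE_comp hZ' hW', principalPartsRes_comp, h2, principalPartsRes_comp]
  -- Near each point `s` comes from a presheaf element over a basis neighbourhood; the values of `φ`
  -- on these agree on overlaps and glue to `t`.
  have key : ∀ (W' : X.Opens) (h' : W' ≤ W) (s : Γ(principalParts k M n, W')),
      ∃ t : Γ(G, W'), ∀ Z (hZ : Z ≤ W') (hb : IsBasisOn β Z) p,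
        principalPartsSection k M n Z p = (principalParts k M n).presheaf.map (homOfLE hZ).op s →
        φ Z (hZ.trans h') hb p = G.presheaf.map (homOfLE hZ).op t := by
    intro W' h' s
    have hloc : ∀ x : W', ∃ (Z : X.Opens) (hZ : Z ≤ W') (p : _), x.1 ∈ Z ∧ IsBasisOn β Z ∧
        principalPartsSection k M n Z p =
          (principalParts k M n).presheaf.map (homOfLE hZ).op s := by
      intro x
      obtain ⟨N, hN, p, hxN, hp⟩ := exists_principalPartsSection_eq s x.2
      obtain ⟨Z, hZ, hxZ, hb⟩ := hβ N (hN.trans (h'.trans hW)) x hxN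
      refine ⟨Z, hZ.trans hN, principalPartsRes k M n (homOfLE hZ) p, hxZ, hb, ?_⟩
      rw [← map_principalPartsSection, hp, Modules.map_map, homOfLE_comp]
    choose Z hZ p hxZ hb hp using hloc
    have hagree : ∀ x Z' (hx : Z' ≤ Z x) (hb' : IsBasisOn β Z') q,
        principalPartsSection k M n Z' q =
          (principalParts k M n).presheaf.map (homOfLE (hx.trans (hZ x))).op s →
        φ Z' ((hx.trans (hZ x)).trans h') hb' q =
          G.presheaf.map (homOfLE hx).op (φ (Z x) ((hZ x).trans h') (hb x) (p x)) := by
      intro x Z' hx hb' q hq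
      rw [← hφres _ _ (hb x) Z' hx hb']
      refine hφext _ _ hb' _ _ ?_
      rw [hq, ← map_principalPartsSection, hp, Modules.map_map, homOfLE_comp]
    obtain ⟨t, ht, -⟩ := G.existsUnique_gluing Z W' hZ
      (fun x hx ↦ Opens.mem_iSup.2 ⟨⟨x, hx⟩, hxZ _⟩)
      (fun x ↦ φ (Z x) ((hZ x).trans h') (hb x) (p x)) fun x y ↦ by
        refine hβ.section_ext ((inf_le_left.trans (hZ x)).trans (h'.trans hW))
          fun z hz ↦ ⟨_, le_rfl, hz, fun Z' hZ' hb' ↦ ?_⟩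
        rw [Modules.map_map, Modules.map_map, homOfLE_comp, homOfLE_comp]
        have hx := hZ'.trans inf_le_left
        rw [← hagree x Z' (hZ'.trans inf_le_left) hb' (principalPartsRes k M n (homOfLE hx) (p x)),
          hagree y Z' (hZ'.trans inf_le_right) hb']
        all_goals rw [← map_principalPartsSection, hp, Modules.map_map, homOfLE_comp]
    refine ⟨t, fun Z' hZ' hb' q hq ↦ ?_⟩
    refine hβ.section_ext (hZ'.trans (h'.trans hW)) fun x hx ↦
      ⟨Z' ⊓ Z ⟨x, hZ' hx⟩, inf_le_left, ⟨hx, hxZ _⟩, fun Z'' hZ'' hb'' ↦ ?_⟩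
    rw [← hφres _ _ hb' Z'' (hZ''.trans inf_le_left) hb'',
      hagree ⟨x, hZ' hx⟩ Z'' (hZ''.trans inf_le_right) hb'', ← ht, Modules.map_map,
      Modules.map_map, homOfLE_comp, homOfLE_comp]
    rw [← map_principalPartsSection, hq, Modules.map_map, homOfLE_comp]
  choose g hg using key
  -- To identify `g s` it suffices to test one presheaf representative of `s` near each point.
  -- Additivity, linearity and compatibility with restriction all follow by choosing suitable
  -- representatives.
  have huniq : ∀ (W' : X.Opens) (h' : W' ≤ W) (s : Γ(principalParts k M n, W')) (t : Γ(G, W')),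
      (∀ x ∈ W', ∃ (N : X.Opens) (hN : N ≤ W') (p : _), x ∈ N ∧ principalPartsSection k M n N p =
          (principalParts k M n).presheaf.map (homOfLE hN).op s ∧
        ∀ Z (hZ : Z ≤ N) (hb : IsBasisOn β Z), φ Z ((hZ.trans hN).trans h') hb
          (principalPartsRes k M n (homOfLE hZ) p) =
            G.presheaf.map (homOfLE (hZ.trans hN)).op t) → g W' h' s = t := by
    intro W' h' s t ht
    refine hβ.section_ext (h'.trans hW) fun x hx ↦ ?_
    obtain ⟨N, hN, p, hxN, hp, H⟩ := ht x hx
    refine ⟨N, hN, hxN, fun Z hZ hb ↦ ?_⟩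
    rw [← H Z hZ hb]
    refine (hg W' h' s Z (hZ.trans hN) hb _ ?_).symm
    rw [← map_principalPartsSection, hp, Modules.map_map, homOfLE_comp]
  have hgres : ∀ (W' : X.Opens) (h' : W' ≤ W) (s : Γ(principalParts k M n, W')) N (hN : N ≤ W')
      (p : ModulePrincipalParts k Γ(X, N) n Γ(M, N)), principalPartsSection k M n N p =
        (principalParts k M n).presheaf.map (homOfLE hN).op s → ∀ Z (hZ : Z ≤ N)
        (hb : IsBasisOn β Z), φ Z ((hZ.trans hN).trans h') hb
          (principalPartsRes k M n (homOfLE hZ) p) =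
            G.presheaf.map (homOfLE (hZ.trans hN)).op (g W' h' s) := by
    intro W' h' s N hN p hp Z hZ hb
    refine hg W' h' s Z (hZ.trans hN) hb _ ?_
    rw [← map_principalPartsSection, hp, Modules.map_map, homOfLE_comp]
  have hadd : ∀ (W' : X.Opens) (h' : W' ≤ W) (s s' : Γ(principalParts k M n, W')),
      g W' h' (s + s') = g W' h' s + g W' h' s' := by
    refine fun W' h' s s' ↦ huniq _ _ _ _ fun x hx ↦ ?_
    obtain ⟨N, hN, p, hxN, hp⟩ := exists_principalPartsSection_eq s hx
    obtain ⟨N', hN', p', hxN', hp'⟩ := exists_principalPartsSection_eq s' hx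
    refine ⟨N ⊓ N', inf_le_left.trans hN, principalPartsRes k M n (homOfLE inf_le_left) p +
      principalPartsRes k M n (homOfLE inf_le_right) p', ⟨hxN, hxN'⟩, ?_, fun Z hZ hb ↦ ?_⟩
    · rw [map_add, ← map_principalPartsSection, ← map_principalPartsSection, hp, hp',
        Modules.map_map, Modules.map_map, homOfLE_comp, homOfLE_comp, ← map_add]
    · rw [map_add, map_add, map_add, ← principalPartsRes_comp, ← principalPartsRes_comp,
        homOfLE_comp, homOfLE_comp, hgres W' h' s N hN p hp Z (hZ.trans inf_le_left) hb,
        hgres W' h' s' N' hN' p' hp' Z (hZ.trans inf_le_right) hb]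
  have hsmul : ∀ (W' : X.Opens) (h' : W' ≤ W) (r : Γ(X, W')) (s : Γ(principalParts k M n, W')),
      g W' h' (r • s) = r • g W' h' s := by
    refine fun W' h' r s ↦ huniq _ _ _ _ fun x hx ↦ ?_
    obtain ⟨N, hN, p, hxN, hp⟩ := exists_principalPartsSection_eq s hx
    refine ⟨N, hN, X.presheaf.map (homOfLE hN).op r • p, hxN, ?_, fun Z hZ hb ↦ ?_⟩
    · rw [principalPartsSection_smul, hp, Modules.map_smul]
    · rw [principalPartsRes_smul, _root_.map_smul, hgres _ _ s N hN p hp Z hZ hb,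
        Modules.ring_map_map, homOfLE_comp]
      exact (Modules.map_smul G _ _ _).symm
  have hres : ∀ (W' Z₀ : X.Opens) (h' : W' ≤ W) (i : Z₀ ⟶ W')
      (s : Γ(principalParts k M n, W')), g Z₀ (i.le.trans h')
        ((principalParts k M n).presheaf.map i.op s) = G.presheaf.map i.op (g W' h' s) := by
    refine fun W' Z₀ h' i s ↦ huniq _ _ _ _ fun x hx ↦ ?_
    obtain ⟨N, hN, p, hxN, hp⟩ := exists_principalPartsSection_eq
      ((principalParts k M n).presheaf.map i.op s) hx
    refine ⟨N, hN, p, hxN, hp, fun Z hZ hb ↦ ?_⟩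
    rw [Modules.map_map] at hp
    rw [hgres _ h' s N (hN.trans i.le) p hp Z hZ hb, Modules.map_map]
    rfl
  let P : (principalParts k M n).LocalHom G W :=
    ⟨fun W' ↦ AddMonoidHom.mk' (g W'.1 W'.2) (hadd W'.1 W'.2), hsmul, hres⟩
  refine ⟨P, fun j ↦ huniq _ _ _ _ fun x hx ↦
    ⟨W, le_rfl, principalPartsRes k M n (homOfLE hW) (β j), hx, ?_, fun Z hZ hb ↦ ?_⟩⟩
  · exact ((principalParts k M n).map_id_apply _ _).symm
  · rw [← principalPartsRes_comp, homOfLE_comp, hφ Z hZ hb]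

/-- Homomorphisms out of the sheaf of principal parts are determined by a local frame. -/
theorem IsLocalFrame.localHom_ext [Finite J] (hβ : IsLocalFrame β) {W : X.Opens} (hW : W ≤ U)
    {P Q : (principalParts k M n).LocalHom G W}
    (h : ∀ j, P.app W le_rfl (principalPartsSection k M n W
        (principalPartsRes k M n (homOfLE hW) (β j))) =
      Q.app W le_rfl (principalPartsSection k M n W
        (principalPartsRes k M n (homOfLE hW) (β j)))) : P = Q := by
  have := Fintype.ofFinite J
  ext W' h' s
  refine hβ.section_ext (h'.trans hW) fun x hx ↦ ?_
  obtain ⟨N, hN, p, hxN, hp⟩ := exists_principalPartsSection_eq s hx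
  refine ⟨N, hN, hxN, fun Z hZ hb ↦ ?_⟩
  -- On a small neighbourhood `s` is a combination of the frame, on which `P` and `Q` agree.
  obtain ⟨a, ha⟩ := hb.exists_eq_sum (principalPartsRes k M n (homOfLE hZ) p)
  have h1 : (principalParts k M n).presheaf.map (homOfLE (hZ.trans hN)).op s =
      principalPartsSection k M n Z (principalPartsRes k M n (homOfLE hZ) p) := by
    rw [← map_principalPartsSection, hp, Modules.map_map, homOfLE_comp]
  have h2 : ∀ j, principalPartsSection k M n Z (principalPartsRes k M n (homOfLE hb.1) (β j)) =
      (principalParts k M n).presheaf.map (homOfLE ((hZ.trans hN).trans h')).op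
        (principalPartsSection k M n W (principalPartsRes k M n (homOfLE hW) (β j))) := fun j ↦ by
    rw [map_principalPartsSection, ← principalPartsRes_comp, homOfLE_comp]
  rw [← P.map_res, ← Q.map_res, h1, ha]
  simp only [map_sum, principalPartsSection_smul, Modules.LocalHom.map_smul, h2]
  refine Finset.sum_congr rfl fun j _ ↦ ?_
  have h3 := congrArg (G.presheaf.map (homOfLE ((hZ.trans hN).trans h')).op) (h j)
  rw [← P.map_res, ← Q.map_res] at h3
  rw [h3]

end LocalFrame
end AlgebraicGeometry.Scheme

/-- The inclusions and projections of an object isomorphic to a finite copower. -/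
theorem CategoryTheory.Limits.IsColimit.exists_inclusion_projection {C : Type*} [Category C]
    [Preadditive C] {I : Type*} [Fintype I] [DecidableEq I] {O F : C} {c : Limits.Cofan fun _ : I ↦ O}
    (hc : Limits.IsColimit c) (φ : F ≅ c.pt) :
    ∃ (ι : I → (O ⟶ F)) (π : I → (F ⟶ O)),
      (∀ i j, ι i ≫ π j = if i = j then 𝟙 O else 0) ∧ ∑ j, π j ≫ ι j = 𝟙 F := by
  let pr : ∀ j, c.pt ⟶ O := fun j ↦ Limits.Cofan.IsColimit.desc hc
    (fun i ↦ if i = j then 𝟙 O else 0)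
  have hpr : ∀ i j, c.inj i ≫ pr j = if i = j then 𝟙 O else 0 := fun i j ↦
    Limits.Cofan.IsColimit.fac hc _ i
  refine ⟨fun i ↦ c.inj i ≫ φ.inv, fun j ↦ φ.hom ≫ pr j, fun i j ↦ ?_, ?_⟩
  · rw [Category.assoc, Iso.inv_hom_id_assoc, hpr]
  · have h : ∑ j, pr j ≫ c.inj j = 𝟙 c.pt := by
      refine Limits.Cofan.IsColimit.hom_ext hc _ _ fun i ↦ ?_
      simp [Preadditive.comp_sum, reassoc_of% hpr, ite_comp]
    have h' : ∀ j, (φ.hom ≫ pr j) ≫ c.inj j ≫ φ.inv = φ.hom ≫ (pr j ≫ c.inj j) ≫ φ.inv :=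
      fun j ↦ by simp only [Category.assoc]
    simp only [h']
    rw [← Preadditive.comp_sum, ← Preadditive.sum_comp, h, Category.id_comp, Iso.hom_inv_id]

/-! ### Bases of sections of locally free sheaves -/

namespace AlgebraicGeometry.Scheme.Modules

/-- A sheaf of modules isomorphic to `𝒪_X ^ r` has global sections that restrict to bases. -/
theorem exists_basis_of_iso_free {X : Scheme.{u}} {F : X.Modules} {I : Type u} [Finite I]
    (φ : F ≅ (SheafOfModules.free (R := X.ringCatSheaf) I : X.Modules)) :
    ∃ e : I → Γ(F, ⊤), ∀ W : X.Opens, ∃ b : Module.Basis I Γ(X, W) Γ(F, W),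
      ∀ i, b i = F.presheaf.map (homOfLE le_top).op (e i) := by
  classical
  have := Fintype.ofFinite I
  let O : X.Modules := SheafOfModules.unit X.ringCatSheaf
  let c : Limits.Cofan (C := X.Modules) fun _ : I ↦ O :=
    SheafOfModules.freeCofan (R := X.ringCatSheaf) I
  have hc : Limits.IsColimit c := SheafOfModules.isColimitFreeCofan (R := X.ringCatSheaf) I
  obtain ⟨ι, π, h1, h2⟩ := Limits.IsColimit.exists_inclusion_projection hc φ
  -- Sections of the unit module are functions by definition; `one` is the function `1` typed as
  -- such a section.
  let one : ∀ W : X.Opens, Γ(O, W) := fun W ↦ (1 : Γ(X, W))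
  have hone : ∀ (W : X.Opens) (r : Γ(X, W)), r • one W = (r : Γ(O, W)) := fun W r ↦ mul_one r
  have hres : ∀ W : X.Opens, O.presheaf.map (homOfLE (le_top : W ≤ ⊤)).op (one ⊤) = one W :=
    fun W ↦ map_one (X.presheaf.map (homOfLE (le_top : W ≤ ⊤)).op).hom
  have happ : ∀ {A B : X.Modules} (f : A ⟶ B) (W : X.Opens) (a : Γ(A, ⊤)),
      B.presheaf.map (homOfLE (le_top : W ≤ ⊤)).op (f.app ⊤ a) =
        f.app W (A.presheaf.map (homOfLE (le_top : W ≤ ⊤)).op a) := fun f W a ↦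
    congr($(f.mapPresheaf.naturality (homOfLE (le_top : W ≤ ⊤)).op) a).symm
  have h1' : ∀ i j W (r : Γ(O, W)), (π j).app W ((ι i).app W r) = if i = j then r else 0 := by
    intro i j W r
    have h := congr(($(h1 i j)).app W r)
    refine h.trans ?_
    split_ifs <;> rfl
  have h2' : ∀ W (m : Γ(F, W)), ∑ j, (ι j).app W ((π j).app W m) = m := by
    intro W m
    let ev : (F ⟶ F) →+ Γ(F, W) := AddMonoidHom.mk' (fun f ↦ f.app W m) fun _ _ ↦ rfl
    have h := congrArg ev h2
    rw [map_sum] at h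
    exact h
  refine ⟨fun i ↦ (ι i).app ⊤ (one ⊤), fun W ↦ ?_⟩
  let ε : Γ(F, W) ≃ₗ[Γ(X, W)] (I → Γ(X, W)) :=
    { toFun := fun m i ↦ (π i).app W m
      invFun := fun c ↦ ∑ i, (ι i).app W (c i)
      map_add' := fun m m' ↦ funext fun i ↦ map_add _ _ _
      map_smul' := fun r m ↦ funext fun i ↦ Hom.app_smul _ _ _
      left_inv := h2' W
      right_inv := fun c ↦ funext fun j ↦ by
        refine (map_sum ((π j).app W).hom _ _).trans ?_
        refine (Finset.sum_congr rfl fun i _ ↦ h1' i j W (c i)).trans ?_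
        exact (Finset.sum_ite_eq' Finset.univ j c).trans (if_pos (Finset.mem_univ j)) }
  refine ⟨Module.Basis.ofEquivFun ε, fun i ↦ ?_⟩
  rw [happ, hres, Module.Basis.coe_ofEquivFun]
  refine (Finset.sum_eq_single i (fun j _ hj ↦ ?_) fun h ↦ (h (Finset.mem_univ i)).elim).trans ?_
  · rw [Pi.single_eq_of_ne hj]
    exact map_zero ((ι j).app W).hom
  · rw [Pi.single_eq_same]

/-- A locally free sheaf of modules has, locally, sections that restrict to bases. -/
theorem IsLocallyFreeOfFiniteRank.exists_basis {X : Scheme.{u}} {M : X.Modules}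
    (hM : M.IsLocallyFreeOfFiniteRank) (x : X) :
    ∃ U : X.Opens, x ∈ U ∧ ∃ (r : ℕ) (e : Fin r → Γ(M, U)), ∀ (W : X.Opens) (h : W ≤ U),
      ∃ b : Module.Basis (Fin r) Γ(X, W) Γ(M, W),
        ∀ i, b i = M.presheaf.map (homOfLE h).op (e i) := by
  obtain ⟨U, hxU, r, ⟨φ⟩⟩ := hM x
  obtain ⟨e, he⟩ := exists_basis_of_iso_free φ
  refine ⟨U, hxU, r, fun i ↦ M.presheaf.map (eqToHom U.ι_image_top.symm).op (e ⟨i⟩),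
    fun W h ↦ ?_⟩
  obtain ⟨W, rfl⟩ : ∃ W' : U.toScheme.Opens, W = U.ι ''ᵁ W' :=
    ⟨U.ι ⁻¹ᵁ W, by rw [Hom.image_preimage_eq_opensRange_inf, Opens.opensRange_ι,
      inf_eq_right.2 h]⟩
  obtain ⟨b, hb⟩ := he W
  -- Sections of `M.restrict U.ι` over `W` are sections of `M` over the image of `W`. The two scalar
  -- actions differ by this ring isomorphism, which is the identity.
  have hid : ∀ s : Γ(U, W), (U.ι.appIso W).inv s = (s : Γ(X, U.ι ''ᵁ W)) := fun s ↦ by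
    rw [Opens.ι_appIso]
    rfl
  let act : Γ(X, U.ι ''ᵁ W) → Γ(M, U.ι ''ᵁ W) → Γ(M, U.ι ''ᵁ W) := fun t m ↦ t • m
  have hsmul : ∀ (s : Γ(U, W)) (m : Γ(M.restrict U.ι, W)), s • m = act s m :=
    fun s m ↦ congrArg (fun t ↦ act t m) (hid s)
  have hb' : ∀ (s : Γ(U, W)) (m : Γ(M.restrict U.ι, W)),
      b.equivFun (act s m) = s • b.equivFun m := fun s m ↦
    (congrArg b.equivFun (hsmul s m)).symm.trans (b.equivFun.map_smul s m)
  let ε : Γ(M, U.ι ''ᵁ W) ≃ₗ[Γ(X, U.ι ''ᵁ W)] (Fin r → Γ(X, U.ι ''ᵁ W)) :=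
    { toFun := fun m i ↦ b.equivFun m ⟨i⟩
      invFun := fun c ↦ b.equivFun.symm fun i ↦ c i.down
      map_add' := fun m m' ↦ funext fun i ↦ congrFun (map_add b.equivFun _ _) _
      map_smul' := fun s m ↦ funext fun i ↦ congrFun (hb' s m) ⟨i⟩
      left_inv := fun m ↦ b.equivFun.symm_apply_apply m
      right_inv := fun c ↦ funext fun i ↦ congrFun (b.equivFun.apply_symm_apply _) _ }
  refine ⟨Module.Basis.ofEquivFun ε, fun i ↦ ?_⟩
  refine Eq.trans (b := M.presheaf.map (homOfLE (U.ι.image_mono le_top)).op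
    (e ⟨i⟩ : Γ(M, U.ι ''ᵁ ⊤))) ?_ (M.map_map _ _ _).symm
  refine Eq.trans ?_ (hb ⟨i⟩)
  rw [Module.Basis.coe_ofEquivFun]
  refine (LinearEquiv.symm_apply_eq ε).2 (funext fun j ↦ ?_)
  refine Eq.trans ?_ (b.equivFun_self ⟨i⟩ ⟨j⟩).symm
  rw [Pi.single_apply]
  simp only [ULift.up_inj, eq_comm]
  rfl

end AlgebraicGeometry.Scheme.Modules

/-! ### Exact differentials on regular schemes -/

/-- A basis of exact differentials remains one after a formally étale extension. -/
theorem KaehlerDifferential.exists_basis_of_formallyEtale {k R S ι : Type*} [CommRing k]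
    [CommRing R] [CommRing S] [Algebra k R] [Algebra k S] [Algebra R S] [IsScalarTower k R S]
    [Algebra.FormallyEtale R S] {f : ι → R}
    (h : ∃ b : Module.Basis ι R Ω[R⁄k], ∀ i, b i = KaehlerDifferential.D k R (f i)) :
    ∃ b : Module.Basis ι S Ω[S⁄k], ∀ i, b i = KaehlerDifferential.D k S (algebraMap R S (f i)) := by
  obtain ⟨b, hb⟩ := h
  refine ⟨(b.baseChange S).map (tensorKaehlerEquivOfFormallyEtale k R S), fun i ↦ ?_⟩
  rw [Module.Basis.map_apply, Module.Basis.baseChange_apply, hb,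
    ← tensorKaehlerEquivOfFormallyEtale_symm_D_algebraMap, LinearEquiv.apply_symm_apply]

namespace AlgebraicGeometry.Scheme

variable (k : Type u) [Field k] {X : Scheme.{u}} [X.Over (Spec (CommRingCat.of k))]

theorem finiteType_sections [LocallyOfFiniteType (X ↘ Spec (CommRingCat.of k))] {U : X.Opens}
    (hU : IsAffineOpen U) : Algebra.FiniteType k Γ(X, U) := by
  have h := (X ↘ Spec (CommRingCat.of k)).finiteType_appLE (isAffineOpen_top _) hU le_top
  have h' : algebraMap k Γ(X, U) = ((X ↘ Spec (CommRingCat.of k)).appLE ⊤ U le_top).hom.comp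
      (Scheme.ΓSpecIso (CommRingCat.of k)).commRingCatIsoToRingEquiv.symm.toRingHom := rfl
  rw [← RingHom.finiteType_algebraMap, h']
  exact h.comp (RingHom.FiniteType.of_surjective _ (RingEquiv.surjective _))

/-- A regular point of a scheme locally of finite type over a perfect field has an affine open
neighbourhood with functions whose differentials are a basis on every principal open subset. -/
theorem exists_basis_kaehlerDifferential [PerfectField k]
    [LocallyOfFiniteType (X ↘ Spec (CommRingCat.of k))] (x : X)
    (hx : IsRegularLocalRing (X.presheaf.stalk x)) {N : X.Opens} (hxN : x ∈ N) :
    ∃ U ≤ N, x ∈ U ∧ IsAffineOpen U ∧ ∃ (d : ℕ) (f : Fin d → Γ(X, U)), ∀ h : Γ(X, U),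
      ∃ b : Module.Basis (Fin d) Γ(X, X.basicOpen h) Ω[Γ(X, X.basicOpen h)⁄k],
        ∀ i, b i = KaehlerDifferential.D k _
          (X.presheaf.map (homOfLE (X.basicOpen_le h)).op (f i)) := by
  obtain ⟨U, hU, hxU, hUN⟩ := exists_isAffineOpen_mem_and_subset hxN
  have := finiteType_sections k hU
  let p := (hU.primeIdealOf ⟨x, hxU⟩).asIdeal
  let := X.presheaf.algebra_section_stalk ⟨x, hxU⟩
  have hloc : IsLocalization.AtPrime (X.presheaf.stalk x) p := hU.isLocalization_stalk ⟨x, hxU⟩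
  have : IsRegularLocalRing (Localization.AtPrime p) :=
    .of_ringEquiv (IsLocalization.algEquiv p.primeCompl (X.presheaf.stalk x)
      (Localization.AtPrime p)).toRingEquiv
  obtain ⟨g, hg, d, b, f, hb⟩ :=
    exists_basis_kaehlerDifferential_of_isRegularLocalRing k Γ(X, U) p
  have := hU.isLocalization_basicOpen g
  have : IsScalarTower k Γ(X, U) Γ(X, X.basicOpen g) :=
    .of_algebraMap_eq fun c ↦ (map_fieldToSections k (homOfLE (X.basicOpen_le g)) c).symm
  let e := IsLocalization.algEquiv (Submonoid.powers g) (Localization.Away g) Γ(X, X.basicOpen g)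
  -- Viewing the isomorphism as a formally étale algebra lets one lemma transport the basis both
  -- here and to the smaller principal opens.
  let _ : Algebra (Localization.Away g) Γ(X, X.basicOpen g) := e.toRingEquiv.toRingHom.toAlgebra
  have : Algebra.FormallyEtale (Localization.Away g) Γ(X, X.basicOpen g) :=
    .of_equiv (A := Localization.Away g) { e.toRingEquiv with commutes' := fun _ ↦ rfl }
  have : IsScalarTower k (Localization.Away g) Γ(X, X.basicOpen g) :=
    .of_algebraMap_eq fun c ↦ ((e.restrictScalars k).commutes c).symm
  have hb' := KaehlerDifferential.exists_basis_of_formallyEtale (S := Γ(X, X.basicOpen g)) ⟨b, hb⟩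
  refine ⟨X.basicOpen g, (X.basicOpen_le g).trans hUN, ?_, hU.basicOpen g, d,
    fun i ↦ e (f i), fun h ↦ ?_⟩
  · rw [X.mem_basicOpen g x hxU]
    exact IsLocalization.map_units (M := p.primeCompl) (X.presheaf.stalk x) ⟨g, hg⟩
  · have := (hU.basicOpen g).isLocalization_basicOpen h
    have : IsScalarTower k Γ(X, X.basicOpen g) Γ(X, X.basicOpen h) :=
      .of_algebraMap_eq fun c ↦ (map_fieldToSections k (homOfLE (X.basicOpen_le h)) c).symm
    have : Algebra.FormallyEtale Γ(X, X.basicOpen g) Γ(X, X.basicOpen h) :=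
      Algebra.FormallyEtale.of_isLocalization (Submonoid.powers h)
    exact KaehlerDifferential.exists_basis_of_formallyEtale hb'

end AlgebraicGeometry.Scheme

/-! ### Local frames of the sheaf of principal parts -/

namespace AlgebraicGeometry.Scheme

variable {k : Type u} [Field k] {X : Scheme.{u}} [X.Over (Spec (CommRingCat.of k))]
  {M : X.Modules}

theorem principalPartsRes_monomial {ι κ : Type*} [Finite ι] (n : ℕ) {U W : X.Opens} (i : W ⟶ U)
    (f : ι → Γ(X, U)) (e : κ → Γ(M, U)) (j : exponents ι n × κ) :
    principalPartsRes k M n i (ModulePrincipalParts.monomial k f n e j) =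
      ModulePrincipalParts.monomial k (fun a ↦ X.presheaf.map i.op (f a)) n
        (fun l ↦ M.presheaf.map i.op (e l)) j := by
  refine (principalPartsRes_tmul k M n i _ _).trans ?_
  rw [PrincipalParts.map_monomial]
  rfl

/-- On a regular scheme locally of finite type over a field of characteristic zero, the sheaf of
principal parts of a locally free sheaf has local frames. -/
theorem exists_isLocalFrame [CharZero k] [LocallyOfFiniteType (X ↘ Spec (CommRingCat.of k))]
    (hreg : ∀ x : X, IsRegularLocalRing (X.presheaf.stalk x))
    (hM : M.IsLocallyFreeOfFiniteRank) (n : ℕ) (x : X) :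
    ∃ U : X.Opens, x ∈ U ∧ ∃ (J : Type) (_ : Finite J)
      (β : J → ModulePrincipalParts k Γ(X, U) n Γ(M, U)), IsLocalFrame β ∧ IsBasisOn β U := by
  obtain ⟨N, hxN, r, e, he⟩ := hM.exists_basis x
  obtain ⟨U, hUN, hxU, hU, d, f, hf⟩ := exists_basis_kaehlerDifferential k x (hreg x) hxN
  let β : exponents (Fin d) n × Fin r → ModulePrincipalParts k Γ(X, U) n Γ(M, U) :=
    ModulePrincipalParts.monomial k f n fun l ↦ M.presheaf.map (homOfLE hUN).op (e l)
  have hβ : ∀ h : Γ(X, U), IsBasisOn β (X.basicOpen h) := by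
    intro h
    obtain ⟨b, hb⟩ := hf h
    obtain ⟨c, hc⟩ := he (X.basicOpen h) ((X.basicOpen_le h).trans hUN)
    obtain ⟨B, hB⟩ := ModulePrincipalParts.exists_basis (k := k) _ b hb n c
    refine ⟨X.basicOpen_le h, B, fun j ↦ ?_⟩
    rw [hB, principalPartsRes_monomial]
    congr 1
    funext l
    rw [hc, Modules.map_map, homOfLE_comp]
  refine ⟨U, hxU, _, inferInstance, β, fun W hW y hy ↦ ?_, ?_⟩
  -- Principal opens form a base of the affine `U`.
  · obtain ⟨h, hh, hy'⟩ := hU.exists_basicOpen_le ⟨y, hy⟩ (hW hy)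
    exact ⟨_, hh, hy', hβ h⟩
  -- `U` is the principal open set of the function `1`.
  · simpa only [X.basicOpen_of_isUnit isUnit_one] using hβ 1

end AlgebraicGeometry.Scheme

/-! ### Right inverses of matrices of functions -/

/-- The injective map `c ↦ c A` of row vectors over a field has a linear left inverse; the rows of
`B` are its values on unit vectors. -/
theorem Matrix.exists_mul_eq_one_of_vecMul_injective {K ι J : Type*} [Field K] [Fintype ι]
    [DecidableEq ι] [Fintype J] (A : Matrix ι J K) (h : ∀ c, Matrix.vecMul c A = 0 → c = 0) :
    ∃ B : Matrix J ι K, A * B = 1 := by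
  classical
  obtain ⟨g, hg⟩ := LinearMap.exists_leftInverse_of_injective A.vecMulLinear
    (LinearMap.ker_eq_bot'.2 h)
  refine ⟨Matrix.of fun j i ↦ g (Pi.single j 1) i, ?_⟩
  ext j i
  have h1 := congrFun (LinearMap.congr_fun hg (Pi.single j 1)) i
  rw [LinearMap.comp_apply, Matrix.vecMulLinear_apply, Matrix.single_one_vecMul] at h1
  rw [Matrix.mul_apply, Matrix.one_apply]
  have h2 : A j = ∑ l, A j l • Pi.single l (1 : K) := by
    rw [← Finset.univ_sum_single (A j)]
    refine Finset.sum_congr rfl fun l _ ↦ ?_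
    rw [← Pi.single_smul]
    simp
  have h3 : g (A j) i = ∑ l, A j l * g (Pi.single l 1) i := by
    conv_lhs => rw [h2]
    simp
  refine h3.symm.trans (h1.trans ?_)
  simp [Pi.single_apply, eq_comm]

namespace AlgebraicGeometry.Scheme

variable {X : Scheme.{u}} {x : X}

theorem exists_evaluation_eq {J : Type*} [Finite J] (c : J → X.residueField x) {U : X.Opens}
    (hx : x ∈ U) : ∃ (W : X.Opens) (_ : W ≤ U) (hW : x ∈ W) (t : J → Γ(X, W)),
      ∀ j, X.evaluation W x hW (t j) = c j := by
  choose s hs using fun j ↦ X.residue_surjective x (c j)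
  choose W hWU hxW t ht using fun j ↦ X.presheaf.exists_le_germ_eq (s j) hx
  let W' : X.Opens := ⟨⋂ j, W j, isOpen_iInter_of_finite fun j ↦ (W j).2⟩
  have hW' : ∀ j, W' ≤ W j := fun j ↦ Set.iInter_subset _ j
  have hxW' : x ∈ W' := Set.mem_iInter.2 hxW
  refine ⟨W' ⊓ U, inf_le_right, ⟨hxW', hx⟩,
    fun j ↦ X.presheaf.map (homOfLE (inf_le_left.trans (hW' j))).op (t j), fun j ↦ ?_⟩
  rw [← hs, ← ht]
  exact congrArg (X.residue x) (X.presheaf.germ_res_apply _ _ _ _)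

theorem evaluation_map {U W : X.Opens} (h : W ≤ U) (hx : x ∈ W) (s : Γ(X, U)) :
    X.evaluation W x hx (X.presheaf.map (homOfLE h).op s) = X.evaluation U x (h hx) s :=
  congrArg (X.residue x) (X.presheaf.germ_res_apply _ _ _ _)

/-- A matrix of functions with linearly independent rows at a point has a right inverse in a
neighbourhood of the point. -/
theorem exists_matrix_mul_eq_one {ι J : Type*} [Fintype ι] [DecidableEq ι] [Fintype J]
    {U : X.Opens} (hx : x ∈ U) (A : Matrix ι J Γ(X, U))
    (hA : ∀ c, Matrix.vecMul c (A.map (X.evaluation U x hx)) = 0 → c = 0) :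
    ∃ (W : X.Opens) (h : W ≤ U) (C : Matrix J ι Γ(X, W)), x ∈ W ∧
      A.map (X.presheaf.map (homOfLE h).op) * C = 1 := by
  obtain ⟨B, hB⟩ := Matrix.exists_mul_eq_one_of_vecMul_injective _ hA
  obtain ⟨W, hW, hxW, t, ht⟩ := exists_evaluation_eq (fun j : J × ι ↦ B j.1 j.2) hx
  let C : Matrix J ι Γ(X, W) := Matrix.of fun j i ↦ t (j, i)
  let D : Matrix ι ι Γ(X, W) := A.map (X.presheaf.map (homOfLE hW).op) * C
  have hD : D.map (X.evaluation W x hxW) = 1 := by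
    have h1 := Matrix.map_mul (L := A.map (X.presheaf.map (homOfLE hW).op)) (M := C)
      (f := (X.evaluation W x hxW).hom)
    refine h1.trans ?_
    rw [← hB]
    congr 1
    · ext i j
      exact evaluation_map hW hxW _
    · ext j i
      exact ht (j, i)
  -- `D = A C` is the identity at `x`, so it is invertible where its determinant is; there `C D⁻¹`
  -- is a right inverse of `A`.
  have hdet : x ∈ X.basicOpen D.det := by
    have h1 : X.evaluation W x hxW D.det = 1 :=
      ((X.evaluation W x hxW).hom.map_det D).trans ((congrArg Matrix.det hD).trans Matrix.det_one)
    rw [← X.evaluation_ne_zero_iff_mem_basicOpen x hxW, h1]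
    exact one_ne_zero
  let ρ := (X.presheaf.map (homOfLE (X.basicOpen_le D.det)).op).hom
  have hu : IsUnit (D.map ρ).det := by
    have := ρ.map_det D
    rw [RingHom.mapMatrix_apply] at this
    rw [← this]
    exact RingedSpace.isUnit_res_basicOpen _ _
  refine ⟨X.basicOpen D.det, (X.basicOpen_le _).trans hW, C.map ρ * (D.map ρ)⁻¹, hdet, ?_⟩
  rw [← Matrix.mul_assoc]
  refine Eq.trans ?_ (Matrix.mul_nonsing_inv _ hu)
  congr 1
  refine Eq.trans ?_ (Matrix.map_mul (L := A.map (X.presheaf.map (homOfLE hW).op)) (M := C)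
    (f := ρ)).symm
  congr 1
  ext i j
  exact (Modules.ring_map_map _ _ _).symm

end AlgebraicGeometry.Scheme

/-! ### Truncation of principal parts -/

section Truncation

variable {k R M : Type*} [CommRing k] [CommRing R] [Algebra k R] [AddCommGroup M] [Module R M]
  {m n : ℕ}

/-- The projection from the principal parts of order `n` to those of order `m ≤ n`. -/
def PrincipalParts.truncate (h : m ≤ n) : PrincipalParts k R n →ₐ[R] PrincipalParts k R m :=
  { Ideal.Quotient.factor (Ideal.pow_le_pow_right (Nat.succ_le_succ h)) with
    commutes' := fun _ ↦ rfl }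

theorem PrincipalParts.truncate_left (h : m ≤ n) (r : R) :
    truncate h (left k R n r) = left k R m r := rfl

/-- The projection from the principal parts of order `n` to those of order `m ≤ n`. -/
def ModulePrincipalParts.truncate (h : m ≤ n) :
    ModulePrincipalParts k R n M →+ ModulePrincipalParts k R m M :=
  ((PrincipalParts.truncate (k := k) (R := R) h).toLinearMap.rTensor M).toAddMonoidHom

theorem ModulePrincipalParts.truncate_tmul (h : m ≤ n) (p : PrincipalParts k R n) (x : M) :
    truncate h (tmul n p x) = tmul m (PrincipalParts.truncate h p) x := rfl

theorem ModulePrincipalParts.truncate_d (h : m ≤ n) (x : M) :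
    truncate h (d k R n M x) = d k R m M x := by
  rw [d_apply, truncate_tmul, map_one, d_apply]

theorem ModulePrincipalParts.truncate_smul (h : m ≤ n) (r : R)
    (x : ModulePrincipalParts k R n M) : truncate h (r • x) = r • truncate h x := by
  induction x using induction_on with
  | zero => simp
  | tmul p x =>
    simp only [smul_def, smul_tmul, truncate_tmul, map_mul, PrincipalParts.truncate_left]
  | add x y hx hy => simp only [smul_add, map_add, hx, hy]

end Truncation

namespace AlgebraicGeometry.Scheme

variable {k : Type u} [Field k] {X : Scheme.{u}} [X.Over (Spec (CommRingCat.of k))]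
  {M : X.Modules} {V : Submodule k Γ(M, ⊤)}

/-- If injectivity failed in all orders up to `n`, the infimum would be at least `n + 1`.
Injectivity in one lower order `m` suffices later, thanks to truncation. -/
theorem exists_injective_taylorFibre {n : ℕ} {x : X} (h : injOrderAt V x ≤ n) :
    ∃ m ≤ n, Function.Injective (taylorFibre V m x) := by
  by_contra! H
  have h1 : ((n + 1 : ℕ) : ℕ∞) ≤ injOrderAt V x := le_iInf₂ fun m hm ↦ by
    refine Nat.cast_le.2 (Nat.succ_le_of_lt (lt_of_not_ge fun hmn ↦ H m hmn hm))
  exact absurd (Nat.cast_le.1 (h1.trans h)) (by lia)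

theorem principalPartsSection_d (n : ℕ) (U : X.Opens) (m : Γ(M, U)) :
    principalPartsSection k M n U (ModulePrincipalParts.d k Γ(X, U) n Γ(M, U) m) =
      dSections k M n U m := rfl

/-- If the Taylor map is injective on the fibre at `x`, then the coordinates of the Taylor
expansions of linearly independent sections are linearly independent at `x`. -/
theorem vecMul_eq_zero_of_injective_taylorFibre {ι J : Type*} [Fintype ι] [Fintype J] {m n : ℕ}
    (hmn : m ≤ n) {x : X} (hinj : Function.Injective (taylorFibre V m x)) (b : Module.Basis ι k V)
    {U : X.Opens} (hx : x ∈ U) (β : J → ModulePrincipalParts k Γ(X, U) n Γ(M, U))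
    (A : Matrix ι J Γ(X, U)) (hA : ∀ i, ModulePrincipalParts.d k Γ(X, U) n Γ(M, U)
      (resTop V U (b i)) = ∑ j, A i j • β j) (c : ι → X.residueField x)
    (hc : Matrix.vecMul c (A.map (X.evaluation U x hx)) = 0) : c = 0 := by
  -- The truncated frame in the fibre of order `m`. Its elements need not be independent: a relation
  -- between the rows of `A(x)` only has to produce an element killed by the Taylor map of order
  -- `m`.
  let γ : J → (principalParts k M m).fibre x := fun j ↦
    (1 : X.residueField x) ⊗ₜ[X.presheaf.stalk x] (principalParts k M m).germ U x hx
      (principalPartsSection k M m U (ModulePrincipalParts.truncate hmn (β j)))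
  have hval : ∀ i, taylorFibre V m x (1 ⊗ₜ b i) = ∑ j, X.evaluation U x hx (A i j) • γ j := by
    intro i
    have h1 : taylorFibre V m x (1 ⊗ₜ b i) = (1 : X.residueField x) ⊗ₜ[X.presheaf.stalk x]
        (principalParts k M m).germ U x hx (dSections k M m U (resTop V U (b i))) := by
      have h2 : (principalParts k M m).germ U x hx (dSections k M m U (resTop V U (b i))) =
          (principalParts k M m).germ ⊤ x trivial (dSections k M m ⊤ (b i : Γ(M, ⊤))) := by
        refine (congrArg _ (map_dSections k M m (homOfLE le_top) (b i : Γ(M, ⊤))).symm).trans ?_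
        exact TopCat.Presheaf.germ_res_apply (principalParts k M m).presheaf _ _ _ _
      rw [h2, taylorFibre, LinearMap.liftBaseChange_tmul, one_smul]
      rfl
    rw [h1, ← principalPartsSection_d, ← ModulePrincipalParts.truncate_d hmn, hA, map_sum, map_sum,
      map_sum]
    refine (TensorProduct.tmul_sum _ _ _).trans (Finset.sum_congr rfl fun j _ ↦ ?_)
    rw [ModulePrincipalParts.truncate_smul, principalPartsSection_smul, Modules.germ_smul,
      ← TensorProduct.smul_tmul, Algebra.smul_def]
    exact (TensorProduct.smul_tmul' (X.evaluation U x hx (A i j)) (1 : X.residueField x) _).symm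
  have h0 : taylorFibre V m x (∑ i, c i ⊗ₜ b i) = 0 := by
    have h2 : ∀ i, c i ⊗ₜ[k] b i = c i • ((1 : X.residueField x) ⊗ₜ[k] b i) := fun i ↦ by
      rw [TensorProduct.smul_tmul', smul_eq_mul, mul_one]
    simp only [h2, map_sum, map_smul, hval, Finset.smul_sum, smul_smul]
    rw [Finset.sum_comm]
    simp only [← Finset.sum_smul]
    refine Finset.sum_eq_zero fun j _ ↦ ?_
    refine (congrArg (· • γ j) (congrFun hc j)).trans (zero_smul _ _)
  have h1 : ∑ i, c i ⊗ₜ[k] b i = 0 := hinj (h0.trans (map_zero _).symm)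
  refine funext (Fintype.linearIndependent_iff.1 (b.baseChange (X.residueField x)).linearIndependent
    c ?_)
  refine Eq.trans (Finset.sum_congr rfl fun i _ ↦ ?_) h1
  rw [Module.Basis.baseChange_apply, TensorProduct.smul_tmul', smul_eq_mul, mul_one]

end AlgebraicGeometry.Scheme

/-! ### Local sections of the evaluation map -/

namespace AlgebraicGeometry.Scheme

variable {k : Type u} [Field k] {X : Scheme.{u}} [X.Over (Spec (CommRingCat.of k))]
  {M : X.Modules} {V : Submodule k Γ(M, ⊤)} [FiniteDimensional k V] {n : ℕ}

/-- If the matrix of coordinates, in a local frame, of the Taylor expansions of a basis of `V` has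
a right inverse over `W`, then the evaluation map has a section over `W`. -/
theorem IsLocalFrame.exists_section_evalSections {ι J : Type*} [Fintype ι] [DecidableEq ι]
    [Fintype J] (b : Module.Basis ι k V) {U W : X.Opens}
    {β : J → ModulePrincipalParts k Γ(X, U) n Γ(M, U)} (hβ : IsLocalFrame β)
    (A : Matrix ι J Γ(X, U)) (hA : ∀ i, ModulePrincipalParts.d k Γ(X, U) n Γ(M, U)
      (resTop V U (b i)) = ∑ j, A i j • β j) (hW : W ≤ U) (C : Matrix J ι Γ(X, W))
    (hC : A.map (X.presheaf.map (homOfLE hW).op) * C = 1) :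
    ∃ s : ∀ Z : X.Opens, Z ≤ W →
      DualTensor V Z →ₗ[Γ(X, Z)] (principalParts k M n).LocalHom M Z,
      (∀ Z h t, evalSections V n Z (s Z h t) = t) ∧
      ∀ Z h Z' (i : Z' ⟶ Z) t, Modules.LocalHom.res i (s Z h t) =
        s Z' (i.le.trans h) (DualTensor.res V i t) := by
  -- With `P(β j) = ∑ C j l • t(b l)`, one gets `P · b i = ∑ (A C) i l • t(b l) = t(b i)`.
  have key : ∀ (Z : X.Opens) (h : Z ≤ W) (t : DualTensor V Z),
      ∃ P : (principalParts k M n).LocalHom M Z, ∀ j, P.app Z le_rfl (principalPartsSection k M n Z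
        (principalPartsRes k M n (homOfLE (h.trans hW)) (β j))) =
          ∑ i, X.presheaf.map (homOfLE h).op (C j i) • DualTensor.toHom V Z t (b i) :=
    fun Z h t ↦ hβ.exists_localHom_app_eq (h.trans hW) _
  choose s hs using key
  -- The values on the frame determine the chosen operator, so the choice is automatically linear in
  -- `t` and compatible with restriction.
  have hext : ∀ (Z : X.Opens) (h : Z ≤ W) (t : DualTensor V Z)
      (Q : (principalParts k M n).LocalHom M Z), (∀ j, Q.app Z le_rfl (principalPartsSection k M n Z
        (principalPartsRes k M n (homOfLE (h.trans hW)) (β j))) =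
          ∑ i, X.presheaf.map (homOfLE h).op (C j i) • DualTensor.toHom V Z t (b i)) →
      s Z h t = Q := fun Z h t Q hQ ↦
    hβ.localHom_ext (h.trans hW) fun j ↦ (hs Z h t j).trans (hQ j).symm
  have hid : ∀ (Z : X.Opens) (r : Γ(X, Z)), X.presheaf.map (homOfLE (le_refl Z)).op r = r :=
    fun Z r ↦ congr($(X.presheaf.map_id (op Z)) r)
  have hC' : ∀ (Z : X.Opens) (h : Z ≤ W) i l, ∑ j, X.presheaf.map (homOfLE (h.trans hW)).op (A i j) *
      X.presheaf.map (homOfLE h).op (C j l) = if i = l then 1 else 0 := by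
    intro Z h i l
    have h1 := congrArg (X.presheaf.map (homOfLE h).op) (congrFun (congrFun hC i) l)
    rw [Matrix.mul_apply, map_sum, Matrix.one_apply] at h1
    simp only [Matrix.map_apply, map_mul, Modules.ring_map_map, homOfLE_comp] at h1
    rw [h1]
    split_ifs <;> simp
  refine ⟨fun Z h ↦
    { toFun := s Z h
      map_add' := fun t t' ↦ hext _ _ _ _ fun j ↦ ?_
      map_smul' := fun r t ↦ hext _ _ _ _ fun j ↦ ?_ }, fun Z h t ↦ ?_, fun Z h Z' i t ↦ ?_⟩
  · simp only [Modules.LocalHom.add_apply, hs, map_add, LinearMap.add_apply, smul_add,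
      Finset.sum_add_distrib]
  · simp only [RingHom.id_apply, Modules.LocalHom.smul_apply, hs, DualTensor.toHom_smul, hid,
      Finset.smul_sum]
    exact Finset.sum_congr rfl fun i _ ↦ smul_comm _ _ _
  · refine DualTensor.ext V fun v ↦ LinearMap.congr_fun (b.ext fun i ↦ ?_) v
    rw [toHom_evalSections]
    have h1 : ModulePrincipalParts.d k Γ(X, Z) n Γ(M, Z) (resTop V Z (b i)) =
        ∑ j, X.presheaf.map (homOfLE (h.trans hW)).op (A i j) •
          principalPartsRes k M n (homOfLE (h.trans hW)) (β j) := by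
      rw [← map_resTop V (homOfLE (h.trans hW))]
      refine (ModulePrincipalParts.map_d n (resAlgHom k _) (M.presheaf.map _).hom
        (fun r m ↦ M.map_smul _ r m) _).symm.trans ?_
      refine (congrArg (principalPartsRes k M n (homOfLE (h.trans hW))) (hA i)).trans ?_
      simp only [map_sum, principalPartsRes_smul]
    change (s Z h t).app Z le_rfl (principalPartsSection k M n Z _) = _
    rw [h1]
    simp only [map_sum, principalPartsSection_smul, Modules.LocalHom.map_smul, hs, Finset.smul_sum,
      smul_smul]
    rw [Finset.sum_comm]
    simp only [← Finset.sum_smul, hC', ite_smul, one_smul, zero_smul, Finset.sum_ite_eq,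
      Finset.mem_univ, if_true]
  · refine (hext _ _ _ _ fun j ↦ ?_).symm
    have h1 := congrArg (M.presheaf.map i.op) (hs Z h t j)
    rw [← Modules.LocalHom.map_res, map_principalPartsSection, ← principalPartsRes_comp] at h1
    refine h1.trans ?_
    rw [map_sum]
    refine Finset.sum_congr rfl fun l _ ↦ ?_
    rw [Modules.map_smul, Modules.ring_map_map, DualTensor.toHom_res]
    rfl

end AlgebraicGeometry.Scheme

/-! ### Exactness and local splitting of the evaluation sequence -/

namespace AlgebraicGeometry.Scheme

variable {k : Type u} [Field k] {X : Scheme.{u}} [X.Over (Spec (CommRingCat.of k))]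
  {M : X.Modules} {V : Submodule k Γ(M, ⊤)}

section

variable (V) [FiniteDimensional k V] (n : ℕ)

theorem evalSections_smul {U : X.Opens} (r : Γ(X, U))
    (P : (principalParts k M n).LocalHom M U) :
    evalSections V n U (r • P) = r • evalSections V n U P :=
  (evalMap V n).app_smul r P

theorem evalSections_res {U W : X.Opens} (i : W ⟶ U)
    (P : (principalParts k M n).LocalHom M U) :
    evalSections V n W (Modules.LocalHom.res i P) = DualTensor.res V i (evalSections V n U P) :=
  congr($((evalMap V n).mapPresheaf.naturality i.op) P)

theorem mem_annSections_iff {U : X.Opens} {P : (principalParts k M n).LocalHom M U} :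
    P ∈ annSections V n U ↔ evalSections V n U P = 0 := by
  refine ⟨fun h ↦ DualTensor.ext V fun v ↦ ?_, fun h v ↦ ?_⟩
  · rw [toHom_evalSections, map_zero]
    exact h v
  · rw [← toHom_evalSections, h, map_zero]
    rfl

instance : Mono (annι V n) :=
  ⟨fun {T} g h e ↦ Modules.hom_ext _ _ fun U ↦ by
    ext t
    have h1 := congr(($e).app U t)
    exact Subtype.ext h1⟩

/-- The lift to `Annⁿ V` of a homomorphism that is killed by the evaluation map. -/
def annLift {T : X.Modules} (g : T ⟶ diffOps k M n) (hg : g ≫ evalMap V n = 0) : T ⟶ ann V n :=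
  ⟨PresheafOfModules.homMk
    { app := fun U ↦ AddCommGrpCat.ofHom (AddMonoidHom.mk' (fun t : Γ(T, U.unop) ↦
        (⟨g.app U.unop t, (mem_annSections_iff V n).2 congr(($hg).app U.unop t)⟩ :
          annSections V n U.unop)) fun t t' ↦ Subtype.ext (map_add _ _ _))
      naturality := fun U W i ↦ by
        ext t
        exact Subtype.ext congr($(g.mapPresheaf.naturality i) t) }
    (fun U r t ↦ Subtype.ext (g.app_smul (U := U.unop) r t))⟩

theorem annLift_comp {T : X.Modules} (g : T ⟶ diffOps k M n) (hg : g ≫ evalMap V n = 0) :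
    annLift V n g hg ≫ annι V n = g := rfl

/-- Sections of `Annⁿ V` are exactly the operators killed by `Wⁿ`, so the inclusion is a categorical
kernel; no frame is needed here. -/
theorem evalSequence_exact : (evalSequence V n).Exact :=
  ShortComplex.exact_of_f_is_kernel _ (Limits.KernelFork.IsLimit.ofι' (annι V n) _
    fun g hg ↦ ⟨annLift V n g hg, annLift_comp V n g hg⟩)

/-- A natural section of the evaluation map over the open subsets of `W`. -/
structure LocalSection (W : X.Opens) where
  /-- The section over an open subset. -/
  toFun : ∀ Z : X.Opens, Z ≤ W → DualTensor V Z →ₗ[Γ(X, Z)] (principalParts k M n).LocalHom M Z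
  evalSections_toFun : ∀ Z h t, evalSections V n Z (toFun Z h t) = t
  res_toFun : ∀ Z h Z' (i : Z' ⟶ Z) t, Modules.LocalHom.res i (toFun Z h t) =
    toFun Z' (i.le.trans h) (DualTensor.res V i t)

variable {V n}

/-- Every section of `V^* ⊗ M` is locally in the image of `Wⁿ`, and two homomorphisms that agree
locally on sections agree because the target is a sheaf. -/
theorem epi_evalMap (h : ∀ x : X, ∃ W : X.Opens, x ∈ W ∧ Nonempty (LocalSection V n W)) :
    Epi (evalMap V n) := by
  refine ⟨fun {T} g g' e ↦ Modules.hom_ext _ _ fun U ↦ ?_⟩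
  ext t
  choose W hxW hW using h
  refine T.eq_of_locally_eq (fun x : U ↦ U ⊓ W x) U (fun x ↦ inf_le_left)
    (fun x hx ↦ Opens.mem_iSup.2 ⟨⟨x, hx⟩, hx, hxW x⟩) _ _ fun x ↦ ?_
  obtain ⟨s⟩ := hW x
  let i : U ⊓ W x ⟶ U := homOfLE inf_le_left
  have h1 := s.evalSections_toFun (U ⊓ W x) inf_le_right (DualTensor.res V i t)
  have h2 : ∀ g : dualTensor V ⟶ T, T.presheaf.map i.op (g.app U t) =
      (evalMap V n ≫ g).app (U ⊓ W x) (s.toFun (U ⊓ W x) inf_le_right (DualTensor.res V i t)) :=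
    fun g ↦ congr($(g.mapPresheaf.naturality i.op) t).symm.trans
      (congrArg (g.app (U ⊓ W x)) h1.symm)
  rw [h2, h2, e]

namespace LocalSection

variable {W : X.Opens} (s : LocalSection V n W)

/-- The section of the restriction of the evaluation map. -/
def hom : (dualTensor V).restrict W.ι ⟶ (diffOps k M n).restrict W.ι :=
  ⟨PresheafOfModules.homMk
    { app := fun U ↦ AddCommGrpCat.ofHom
        (s.toFun (W.ι ''ᵁ U.unop) (W.ι_image_le _)).toAddMonoidHom
      naturality := fun U U' i ↦ by
        ext t
        exact (s.res_toFun _ _ _ (W.ι.opensFunctor.map i.unop) t).symm }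
    (fun U r t ↦ (s.toFun (W.ι ''ᵁ U.unop) (W.ι_image_le _)).map_smul
      ((W.ι.appIso U.unop).inv r) t)⟩

/-- The projection onto `Annⁿ V` along a local section, on sections. -/
def toAnnSections (Z : X.Opens) (h : Z ≤ W) :
    (principalParts k M n).LocalHom M Z →ₗ[Γ(X, Z)] annSections V n Z where
  toFun P := ⟨P - s.toFun Z h (evalSections V n Z P), (mem_annSections_iff V n).2 (by
    rw [map_sub, s.evalSections_toFun, sub_self])⟩
  map_add' P Q := Subtype.ext (by
    change P + Q - s.toFun Z h (evalSections V n Z (P + Q)) = P - _ + (Q - _)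
    rw [map_add, map_add]
    abel)
  map_smul' r P := Subtype.ext (by
    change r • P - s.toFun Z h (evalSections V n Z (r • P)) = r • (P - _)
    rw [evalSections_smul, map_smul, smul_sub])

/-- The retraction of the restriction of the inclusion of `Annⁿ V`. -/
def retraction : (diffOps k M n).restrict W.ι ⟶ (ann V n).restrict W.ι :=
  ⟨PresheafOfModules.homMk
    { app := fun U ↦ AddCommGrpCat.ofHom
        (s.toAnnSections (W.ι ''ᵁ U.unop) (W.ι_image_le _)).toAddMonoidHom
      naturality := fun U U' i ↦ by
        ext P
        let P' : (principalParts k M n).LocalHom M (W.ι ''ᵁ U.unop) := P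
        let j := W.ι.opensFunctor.map i.unop
        refine Subtype.ext (?_ : Modules.LocalHom.res j P' - s.toFun _ _ (evalSections V n _
          (Modules.LocalHom.res j P')) = Modules.LocalHom.res j (P' - s.toFun _ _ _))
        rw [evalSections_res, map_sub, s.res_toFun] }
    (fun U r P ↦ (s.toAnnSections (W.ι ''ᵁ U.unop) (W.ι_image_le _)).map_smul
      ((W.ι.appIso U.unop).inv r) P)⟩

/-- A local section splits the restriction of the evaluation sequence. -/
def splitting : ((evalSequence V n).map (Modules.restrictFunctor W.ι)).Splitting where
  r := s.retraction
  s := s.hom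
  f_r := Modules.hom_ext _ _ fun U ↦ by
    ext P
    let P' : annSections V n (W.ι ''ᵁ U) := P
    refine Subtype.ext (?_ : P'.1 - s.toFun _ _ (evalSections V n _ P'.1) = P'.1)
    rw [(mem_annSections_iff V n).1 P'.2, map_zero, sub_zero]
  s_g := Modules.hom_ext _ _ fun U ↦ by
    ext t
    exact s.evalSections_toFun _ _ t
  id := Modules.hom_ext _ _ fun U ↦ by
    ext P
    exact sub_add_cancel _ _

end LocalSection

/-- Pointwise heart of the theorem: a bound on the injectivity order at `x` alone produces a section
of `Wⁿ` on a neighbourhood. -/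
theorem exists_localSection [CharZero k] [LocallyOfFiniteType (X ↘ Spec (CommRingCat.of k))]
    (hreg : ∀ x : X, IsRegularLocalRing (X.presheaf.stalk x))
    (hM : M.IsLocallyFreeOfFiniteRank) (x : X) (hn : injOrderAt V x ≤ n) :
    ∃ W : X.Opens, x ∈ W ∧ Nonempty (LocalSection V n W) := by
  obtain ⟨U, hxU, J, _, β, hβ, hβU⟩ := exists_isLocalFrame (k := k) hreg hM n x
  have := Fintype.ofFinite J
  let b := Module.finBasis k V
  choose A hA using fun i ↦ hβU.exists_eq_sum
    (ModulePrincipalParts.d k Γ(X, U) n Γ(M, U) (resTop V U (b i)))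
  -- The coordinates over `U` refer to `β` restricted along the identity of `U`; that restriction is
  -- removed.
  replace hA : ∀ i, ModulePrincipalParts.d k Γ(X, U) n Γ(M, U) (resTop V U (b i)) =
      ∑ j, A i j • β j := fun i ↦ (hA i).trans <| Finset.sum_congr rfl fun j _ ↦
    congrArg (A i j • ·) (principalPartsRes_id k M n U (β j))
  obtain ⟨m, hmn, hinj⟩ := exists_injective_taylorFibre hn
  obtain ⟨W, hW, C, hxW, hC⟩ := exists_matrix_mul_eq_one hxU (Matrix.of A)
    (vecMul_eq_zero_of_injective_taylorFibre hmn hinj b hxU β (Matrix.of A) hA)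
  obtain ⟨s, hs, hs'⟩ := hβ.exists_section_evalSections b (Matrix.of A) hA hW C hC
  exact ⟨W, hxW, ⟨⟨s, hs, hs'⟩⟩⟩

end
end AlgebraicGeometry.Scheme

end

theorem mainTheorem3 (k : Type u) [Field k] [CharZero k]
    (X : Scheme.{u}) [X.Over (Spec (CommRingCat.of k))]
    [IrreducibleSpace X]
    [LocallyOfFiniteType (X ↘ Spec (CommRingCat.of k))]
    [QuasiCompact (X ↘ Spec (CommRingCat.of k))]
    (hreg : ∀ x : X, IsRegularLocalRing (X.presheaf.stalk x))
    (M : X.Modules) (hM : M.IsLocallyFreeOfFiniteRank)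
    (V : Submodule k Γ(M, ⊤)) [FiniteDimensional k V]
    (hV : Scheme.IsSeparatedSubspace V)
    (n : ℕ) (hn : Scheme.injOrder V ≤ n) :
    (Scheme.evalSequence V n).ShortExact ∧
      Scheme.Modules.IsLocallySplit (Scheme.evalSequence V n) := by
  have h := fun x : X ↦ Scheme.exists_localSection hreg hM x ((le_iSup _ x).trans hn)
  refine ⟨?_, fun x ↦ ?_⟩
  · have := Scheme.epi_evalMap h
    exact
      { exact := Scheme.evalSequence_exact V n
        mono_f := inferInstanceAs (Mono (Scheme.annι V n))
        epi_g := inferInstanceAs (Epi (Scheme.evalMap V n)) }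
  · obtain ⟨W, hxW, ⟨s⟩⟩ := h x
    exact ⟨W, hxW, ⟨s.splitting⟩⟩
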